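/- **Theorem 3.5.** Conventions: a lattice point is *even* if it lies in $(2\mathbb N)^n$. A finite nonempty set $\mathscr A\subseteq\mathbb N^n$ is the vertex set of a simplex if it is affinely independent; the interior of the simplex is the set of convex combinations of its vertices with all coefficients positive. A *circuit polynomial* is $\sum_{\alpha\in\mathscr A}c_\alpha x^\alpha-dx^\beta$ with $\mathscr A\subseteq(2\mathbb N)^n$ the vertex set of a simplex, all $c_\alpha>0$, $d\in\mathbb R$, and $\beta\in\mathbb N^n$ in the interior of this simplex. A polynomial is *SONC* if it is a finite sum of circuit polynomials that are nonnegative on $\mathbb R^n$ and of monomial squares $cx^\alpha$ ($c>0$, $\alpha$ even). Let $f=\sum_\alpha f_\alpha x^\alpha\in\mathbb R[x_1,\dots,x_n]$. Put $\Lambda(f)=\{\alpha\in\operatorname{supp}(f)\mid \alpha\in(2\mathbb N)^n,\ f_\alpha>0\}$ and $\Gamma(f)=\operatorname{supp}(f)\setminus\Lambda(f)$. For $\beta\in\Gamma(f)$ let $\mathscr F(\beta)$ be the set of simplices $\Delta$ whose vertex set $V(\Delta)$ is contained in $\Lambda(f)$ and whose interior contains $\beta$. Let $\tilde{\mathscr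 A}$ be the set of those $\alpha\in\Lambda(f)$ that are not a vertex of any $\Delta\in\mathscr F(\beta)$, $\beta\in\Gamma(f)$. (1) For every $\beta\in\Gamma(f)$ and $\Delta\in\mathscr F(\beta)$ there is a finite set $M_{\beta\Delta}\subseteq\mathbb Q^n$ such that: $V(\Delta)\cup\{\beta\}\subseteq M_{\beta\Delta}$; every $u\in M_{\beta\Delta}\setminus V(\Delta)$ is the average $\frac12(v+w)$ of two distinct points $v,w\in M_{\beta\Delta}$; and, in lowest terms, all coordinates of points of $M_{\beta\Delta}$ have odd denominators and all coordinates of points of $M_{\beta\Delta}\setminus\{\beta\}$ have even numerators. (2) For every $\beta\in\Gamma(f)$ and $\Delta\in\mathscr F(\beta)$ let $M_{\beta\Delta}$ be any set as in (1), and for every $u\in M_{\beta\Delta}\setminus V(\Delta)$ let $v_u\ne w_u$ be any two points of $M_{\beta\Delta}$ with $u=\frac12(v_u+w_u)$ (the pair may depend on $\beta$ and $\Delta$ as well as on $u$). Then $f$ is SONC if and only if there are real numbers $a_{\beta\Delta u}^{(j)},b_{\beta\Delta u}^{(j)}$ with $$f=\sum_{\beta\in\Gamma(f)}\ \sum_{\Delta\in\mathscr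 F(\beta)}\ \sum_{u\in M_{\beta\Delta}\setminus V(\Delta)}\ \sum_{j=1}^{2}\Bigl(a_{\beta\Delta u}^{(j)}x^{\frac12v_u}-b_{\beta\Delta u}^{(j)}x^{\frac12w_u}\Bigr)^2+\sum_{\alpha\in\tilde{\mathscr A}}f_\alpha x^\alpha ,$$ as an identity between real linear combinations of monomials with rational exponents. -/

import Mathlib

namespace Sonc

noncomputable section

open MvPolynomial

variable {n : ℕ}

/-- Exponents of monomials in `n` variables are elements of `Fin n →₀ ℕ`.
A lattice point is even if all its coordinates are even. -/
def IsEven (α : Fin n →₀ ℕ) : Prop := ∀ i, Even (α i)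

/-- A lattice point as a point of real affine space. -/
def toReal (α : Fin n →₀ ℕ) : Fin n → ℝ := fun i => (α i : ℝ)

/-- A lattice point as a point of rational space. -/
def toRat (α : Fin n →₀ ℕ) : Fin n → ℚ := fun i => (α i : ℚ)

/-- The finite set `A` is the vertex set of a simplex (of any dimension at most `n`):
it is nonempty and affinely independent. -/
def IsSimplexVertices (A : Finset (Fin n →₀ ℕ)) : Prop :=
  A.Nonempty ∧ AffineIndependent ℝ (fun α : A => toReal (α : Fin n →₀ ℕ))

/-- For `A` the vertex set of a simplex: `β` lies in the (relative) interior of this simplex,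
that is, `β` is a convex combination of the vertices with all coefficients positive. -/
def InSimplexInterior (A : Finset (Fin n →₀ ℕ)) (β : Fin n →₀ ℕ) : Prop :=
  ∃ t : (Fin n →₀ ℕ) → ℝ, (∀ α ∈ A, 0 < t α) ∧ ∑ α ∈ A, t α = 1 ∧
    toReal β = ∑ α ∈ A, t α • toReal α

/-- Circuit polynomials `∑_{α ∈ A} c_α x^α - d x^β`. -/
def IsCircuit (g : MvPolynomial (Fin n) ℝ) : Prop :=
  ∃ (A : Finset (Fin n →₀ ℕ)) (β : Fin n →₀ ℕ) (c : (Fin n →₀ ℕ) → ℝ) (d : ℝ),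
    (∀ α ∈ A, IsEven α) ∧ IsSimplexVertices A ∧ (∀ α ∈ A, 0 < c α) ∧
    InSimplexInterior A β ∧ g = ∑ α ∈ A, monomial α (c α) - monomial β d

/-- Nonnegativity on the whole of `ℝ^n`. -/
def IsNonneg (g : MvPolynomial (Fin n) ℝ) : Prop := ∀ x : Fin n → ℝ, 0 ≤ eval x g

/-- Monomial squares `c x^α`, with `c > 0` and `α` even. -/
def IsMonomialSquare (g : MvPolynomial (Fin n) ℝ) : Prop :=
  ∃ (α : Fin n →₀ ℕ) (c : ℝ), IsEven α ∧ 0 < c ∧ g = monomial α c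

/-- SONC polynomials: finite sums of nonnegative circuit polynomials, where monomial squares
count as nonnegative circuit polynomials. -/
def IsSONC (f : MvPolynomial (Fin n) ℝ) : Prop :=
  f ∈ AddSubmonoid.closure
    {g : MvPolynomial (Fin n) ℝ | (IsCircuit g ∧ IsNonneg g) ∨ IsMonomialSquare g}

open Classical in
/-- `Λ(f)`: the even points of the support with positive coefficient. -/
def Lam (f : MvPolynomial (Fin n) ℝ) : Finset (Fin n →₀ ℕ) :=
  f.support.filter (fun α => IsEven α ∧ 0 < f.coeff α)

/-- `Γ(f)`: the rest of the support. -/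
def Gam (f : MvPolynomial (Fin n) ℝ) : Finset (Fin n →₀ ℕ) := f.support \ Lam f

open Classical in
/-- `𝓕(β)`: the simplices `Δ` with vertices in `Λ(f)` that contain `β` in their interior.
A simplex is represented by its vertex set `V(Δ)`. -/
def simplices (f : MvPolynomial (Fin n) ℝ) (β : Fin n →₀ ℕ) : Finset (Finset (Fin n →₀ ℕ)) :=
  (Lam f).powerset.filter (fun Δ => IsSimplexVertices Δ ∧ InSimplexInterior Δ β)

open Classical in
/-- The points of `Λ(f)` that are not a vertex of any simplex of any `𝓕(β)`, `β ∈ Γ(f)`. -/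
def unused (f : MvPolynomial (Fin n) ℝ) : Finset (Fin n →₀ ℕ) :=
  (Lam f).filter (fun α => ∀ β ∈ Gam f, ∀ Δ ∈ simplices f β, α ∉ Δ)

/-- `u` is the average of the distinct points `v` and `w` of `M`. -/
def IsAverage (M : Finset (Fin n → ℚ)) (u v w : Fin n → ℚ) : Prop :=
  v ∈ M ∧ w ∈ M ∧ v ≠ w ∧ u = (1 / 2 : ℚ) • (v + w)

/-- The vertex set of a simplex, in `ℚ^n`. -/
def ratVertices (A : Finset (Fin n →₀ ℕ)) : Finset (Fin n → ℚ) := A.image toRat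

/-- `M` is an `A`-rational mediated set: it contains `A`, and each of its points outside `A` is the
average of two distinct points of `M`. -/
def IsRationalMediated (A : Finset (Fin n →₀ ℕ)) (M : Finset (Fin n → ℚ)) : Prop :=
  ratVertices A ⊆ M ∧ ∀ u ∈ M \ ratVertices A, ∃ v w, IsAverage M u v w

/-- An `A`-rational mediated set containing `β` all of whose coordinates have odd denominators (in
lowest terms), and whose points other than `β` have coordinates with even numerators. -/
def IsOddMediated (A : Finset (Fin n →₀ ℕ)) (β : Fin n →₀ ℕ) (M : Finset (Fin n → ℚ)) : Prop :=
  IsRationalMediated A M ∧ toRat β ∈ M ∧ (∀ u ∈ M, ∀ i, Odd (u i).den) ∧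
    ∀ u ∈ M, u ≠ toRat β → ∀ i, Even (u i).num

/-- The term `c x^u` with a rational exponent vector `u`, in the algebra over `ℝ` of formal linear
combinations of monomials with exponents in `ℚ^n`, where `x^u * x^v = x^(u + v)`. -/
def ratMonomial (u : Fin n → ℚ) (c : ℝ) : AddMonoidAlgebra ℝ (Fin n → ℚ) :=
  AddMonoidAlgebra.single u c

/-- A polynomial, read as a combination of monomials with rational exponents. -/
def toRatPoly (f : MvPolynomial (Fin n) ℝ) : AddMonoidAlgebra ℝ (Fin n → ℚ) :=
  ∑ α ∈ f.support, ratMonomial (toRat α) (f.coeff α)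

/-- The binomial square `(a x^(v/2) - b x^(w/2))^2`. -/
def binomialSquare (v w : Fin n → ℚ) (a b : ℝ) : AddMonoidAlgebra ℝ (Fin n → ℚ) :=
  (ratMonomial ((1 / 2 : ℚ) • v) a - ratMonomial ((1 / 2 : ℚ) • w) b) ^ 2

end

end Sonc

open Sonc

/-! ### Relative entropy certificates for lower bounds on sums of exponentials. -/

namespace Sonc

open Filter Topology

/-! Both sides of the equivalence in (2) amount to the existence of a distribution
(`IsDistribution`): the positive even coefficients of `f` are shared out among the exponents `β ∈
Γ(f)` so that each share dominates `|f_β| x^β` on the positive orthant.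

Towards a distribution: an AGE signomial at `β` has only nonnegative even terms away from `β`, and
stays nonnegative on the positive orthant when the sign of a non-even `β`-term is flipped.
Nonnegative circuit polynomials are AGE (reflect one coordinate in which `β` is odd), and so are the
binomial squares of the formula, because the endpoints `v_u`, `w_u` in an odd mediated set have odd
denominators and even numerators. A sum of AGE signomials can be rearranged without cancellation
(`exists_forall_noCancellationAt`); then the summand of `β ∈ Γ(f)` involves only `β` and `Λ(f)`,
which is a distribution.

From a distribution: the bound at `β` has an entropy certificate (`exists_entropy_certificate`), a
nonnegative relation that splits conformally into barycentric relations of simplices in `𝓕(β)`. With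
`exp x ≥ 1 + x` this gives circuits with coefficients `N λ_α exp(s_α)` at the vertices and `|D| ≤ N
exp(∑ λ_α s_α)` at `β` (`exists_circuit_certificates`). Such a circuit is nonnegative by weighted
AM-GM, so `f` is SONC. It is also a sum of binomial squares along any mediated set: extend `s`
harmonically to `l`, so that `K = N exp l` satisfies `K(v) K(w) = K(u)²`, and add the squares `K(v)
x^v + K(w) x^w - 2 K(u) x^u` with the weights of the Green function with pole `β`
(`circuit_mem_iSup_binomialCone`). Leftover mass at a vertex of some simplex is absorbed as a
degenerate square.

For (1), weights with odd common denominator `P` are handled by the whole grid of points with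
weights in `(1/P)ℤ`; powers of two are removed one at a time by writing the point as a midpoint
(`exists_mediated_of_two_pow`). -/

/-- Minimizers of a sum of exponentials regularized by `ε ‖y‖²`, with the stationarity
conditions. -/
lemma exists_regularized_critical_point {ι : Type*} [Fintype ι] {n : ℕ} (p : ι → Fin n → ℝ)
    (c : ι → ℝ) (hc : ∀ α, 0 ≤ c α) {ε : ℝ} (hε : 0 < ε) :
    ∃ y : Fin n → ℝ,
      (∑ α, c α * Real.exp (p α ⬝ᵥ y) + ε * (y ⬝ᵥ y) ≤ ∑ α, c α) ∧
      ∀ z : Fin n → ℝ,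
        ∑ α, c α * Real.exp (p α ⬝ᵥ y) * (p α ⬝ᵥ z) + 2 * ε * (y ⬝ᵥ z) = 0 := by
  set F : (Fin n → ℝ) → ℝ := fun y => ∑ α, c α * Real.exp (p α ⬝ᵥ y) + ε * (y ⬝ᵥ y) with hF
  have hcont : Continuous F := by
    simp only [hF, dotProduct]
    fun_prop
  have hnorm : ∀ y : Fin n → ℝ, ‖y‖ ^ 2 ≤ y ⬝ᵥ y := by
    intro y
    have hnn : 0 ≤ y ⬝ᵥ y := Finset.sum_nonneg fun i _ => mul_self_nonneg _
    have : ‖y‖ ≤ Real.sqrt (y ⬝ᵥ y) := by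
      refine (pi_norm_le_iff_of_nonneg (Real.sqrt_nonneg _)).2 fun i => ?_
      rw [Real.norm_eq_abs]
      refine Real.abs_le_sqrt ?_
      rw [sq]
      exact Finset.single_le_sum (f := fun i => y i * y i) (fun i _ => mul_self_nonneg _)
        (Finset.mem_univ i)
    calc ‖y‖ ^ 2 ≤ Real.sqrt (y ⬝ᵥ y) ^ 2 := by gcongr
      _ = _ := Real.sq_sqrt hnn
  -- The sum of exponentials alone need not attain its infimum; the quadratic term makes `F`
  -- coercive.
  have hlim : Tendsto F (cocompact (Fin n → ℝ)) atTop := by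
    have h1 : Tendsto (fun y : Fin n → ℝ => ε * ‖y‖ ^ 2) (cocompact _) atTop :=
      ((tendsto_pow_atTop two_ne_zero).comp (tendsto_norm_cocompact_atTop)).const_mul_atTop hε
    refine tendsto_atTop_mono (fun y => ?_) h1
    have h2 : 0 ≤ ∑ α, c α * Real.exp (p α ⬝ᵥ y) :=
      Finset.sum_nonneg fun α _ => mul_nonneg (hc α) (Real.exp_pos _).le
    have h3 := mul_le_mul_of_nonneg_left (hnorm y) hε.le
    simp only [hF]
    linarith
  obtain ⟨y, hy⟩ := hcont.exists_forall_le hlim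
  refine ⟨y, ?_, fun z => ?_⟩
  · have := hy 0
    simpa [hF] using this
  · set G : ℝ → ℝ := fun s => F (y + s • z) with hG
    have hmin : IsLocalMin G 0 := by
      refine Filter.Eventually.of_forall fun s => ?_
      simpa [hG] using hy (y + s • z)
    have hder : HasDerivAt G
        (∑ α, c α * Real.exp (p α ⬝ᵥ y) * (p α ⬝ᵥ z) + 2 * ε * (y ⬝ᵥ z)) 0 := by
      have h1 : ∀ α, HasDerivAt (fun s : ℝ => c α * Real.exp (p α ⬝ᵥ y + s * (p α ⬝ᵥ z)))
          (c α * Real.exp (p α ⬝ᵥ y) * (p α ⬝ᵥ z)) 0 := by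
        intro α
        have h := ((((hasDerivAt_id (0 : ℝ)).mul_const (p α ⬝ᵥ z)).const_add
          (p α ⬝ᵥ y)).exp).const_mul (c α)
        refine h.congr_deriv ?_
        simp [mul_assoc]
      have h2 : HasDerivAt (fun s : ℝ => ε * (y ⬝ᵥ y + 2 * (s * (y ⬝ᵥ z)) + s ^ 2 * (z ⬝ᵥ z)))
          (2 * ε * (y ⬝ᵥ z)) 0 := by
        have h := (((((hasDerivAt_id (0 : ℝ)).mul_const (y ⬝ᵥ z)).const_mul 2).const_add
          (y ⬝ᵥ y)).add (((hasDerivAt_id (0 : ℝ)).pow 2).mul_const (z ⬝ᵥ z))).const_mul ε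
        refine h.congr_deriv ?_
        simp
        ring
      have h3 := (HasDerivAt.fun_sum fun α (_ : α ∈ Finset.univ) => h1 α).fun_add h2
      refine h3.congr_of_eventuallyEq (Filter.Eventually.of_forall fun s => ?_)
      simp only [hG, hF, dotProduct_add, add_dotProduct, dotProduct_smul, smul_dotProduct,
        smul_eq_mul, dotProduct_comm z y]
      ring
    exact hmin.hasDerivAt_eq_zero hder

/-- A lower bound `d` on a sum of exponentials has a certificate by relative entropy. -/
lemma exists_entropy_certificate {ι : Type*} [Fintype ι] {n : ℕ} (p : ι → Fin n → ℝ)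
    (c : ι → ℝ) (hc : ∀ α, 0 ≤ c α) (d : ℝ)
    (hd : ∀ y, d ≤ ∑ α, c α * Real.exp (p α ⬝ᵥ y)) :
    ∃ ν : ι → ℝ, (∀ α, 0 ≤ ν α) ∧ (∀ α, c α = 0 → ν α = 0) ∧ ∑ α, ν α • p α = 0 ∧
      d ≤ ∑ α, ν α ∧ 0 ≤ ∑ α, ν α * (Real.log (c α) - Real.log (ν α)) := by
  have hex : ∀ k : ℕ, ∃ y : Fin n → ℝ,
      (∑ α, c α * Real.exp (p α ⬝ᵥ y) + (1 / ((k : ℝ) + 1)) * (y ⬝ᵥ y) ≤ ∑ α, c α) ∧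
      ∀ z : Fin n → ℝ, ∑ α, c α * Real.exp (p α ⬝ᵥ y) * (p α ⬝ᵥ z) +
        2 * (1 / ((k : ℝ) + 1)) * (y ⬝ᵥ z) = 0 :=
    fun k => exists_regularized_critical_point p c hc (by positivity)
  choose y hy1 hy2 using hex
  set C := ∑ α, c α with hC
  have hC0 : 0 ≤ C := Finset.sum_nonneg fun α _ => hc α
  set ν : ℕ → ι → ℝ := fun k α => c α * Real.exp (p α ⬝ᵥ y k) with hν
  have hν0 : ∀ k α, 0 ≤ ν k α := fun k α => mul_nonneg (hc α) (Real.exp_pos _).le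
  have hyy : ∀ k, 0 ≤ y k ⬝ᵥ y k := fun k => Finset.sum_nonneg fun i _ => mul_self_nonneg _
  have hνC : ∀ k α, ν k α ≤ C := by
    intro k α
    have h1 : ν k α ≤ ∑ α, ν k α :=
      Finset.single_le_sum (fun α _ => hν0 k α) (Finset.mem_univ α)
    have h2 : 0 ≤ (1 / ((k : ℝ) + 1)) * (y k ⬝ᵥ y k) := mul_nonneg (by positivity) (hyy k)
    linarith [hy1 k]
  obtain ⟨μ, -, φ, hφ, hlim⟩ := (isCompact_univ_pi fun _ : ι => isCompact_Icc (a := (0 : ℝ))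
    (b := C)).tendsto_subseq (x := ν) fun k => Set.mem_univ_pi.2 fun α => ⟨hν0 k α, hνC k α⟩
  have hlimα : ∀ α, Tendsto (fun k => ν (φ k) α) atTop (𝓝 (μ α)) :=
    fun α => (tendsto_pi_nhds.1 hlim) α
  -- Comparing `y k` with the origin gives `ε (y ⬝ᵥ y) ≤ C`, hence `|ε y_i| ≤ √(ε C)`: the
  -- regularization disappears from the stationarity condition in the limit.
  have hsmall : ∀ i, Tendsto (fun k : ℕ => (1 / ((k : ℝ) + 1)) * y k i) atTop (𝓝 0) := by
    intro i
    have hb : ∀ k : ℕ, |(1 / ((k : ℝ) + 1)) * y k i| ≤ Real.sqrt (1 / ((k : ℝ) + 1) * C) := by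
      intro k
      refine Real.abs_le_sqrt ?_
      have h1 : y k i * y k i ≤ y k ⬝ᵥ y k :=
        Finset.single_le_sum (f := fun i => y k i * y k i) (fun i _ => mul_self_nonneg _)
          (Finset.mem_univ i)
      have h0 : 0 < 1 / ((k : ℝ) + 1) := by positivity
      have h2 : 0 ≤ ∑ α, ν k α := Finset.sum_nonneg fun α _ => hν0 k α
      have h3 : (1 / ((k : ℝ) + 1)) * (y k i * y k i) ≤ C := by
        have := mul_le_mul_of_nonneg_left h1 h0.le
        linarith [hy1 k]
      have := mul_le_mul_of_nonneg_left h3 h0.le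
      nlinarith
    have ht : Tendsto (fun k : ℕ => Real.sqrt (1 / ((k : ℝ) + 1) * C)) atTop (𝓝 0) := by
      have h1 := (tendsto_one_div_add_atTop_nhds_zero_nat (𝕜 := ℝ)).mul_const C
      have h2 := (Real.continuous_sqrt.tendsto _).comp h1
      simpa [Function.comp_def] using h2
    exact squeeze_zero_norm hb ht
  refine ⟨μ, fun α => ge_of_tendsto' (hlimα α) fun k => hν0 _ α, fun α h0 => ?_, ?_, ?_, ?_⟩
  · refine tendsto_nhds_unique (hlimα α) ?_
    simp [hν, h0]
  · funext i
    have h1 : Tendsto (fun k => ∑ α, ν (φ k) α * p α i) atTop (𝓝 (∑ α, μ α * p α i)) :=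
      tendsto_finsetSum _ fun α _ => (hlimα α).mul_const _
    have h2 : Tendsto (fun k => ∑ α, ν (φ k) α * p α i) atTop (𝓝 0) := by
      have h3 := ((hsmall i).comp hφ.tendsto_atTop).const_mul (-2)
      rw [mul_zero] at h3
      refine h3.congr fun k => ?_
      have := hy2 (φ k) (Pi.single i 1)
      simp only [dotProduct_single, mul_one] at this
      simp only [Function.comp, hν]
      linarith
    simpa [Finset.sum_apply] using tendsto_nhds_unique h1 h2
  · refine ge_of_tendsto' (tendsto_finsetSum Finset.univ fun α _ => hlimα α) fun k => hd _
  · have h1 : Tendsto (fun k => ∑ α, (ν (φ k) α * Real.log (c α) -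
        ν (φ k) α * Real.log (ν (φ k) α))) atTop
        (𝓝 (∑ α, (μ α * Real.log (c α) - μ α * Real.log (μ α)))) :=
      tendsto_finsetSum _ fun α _ => ((hlimα α).mul_const _).sub
        ((Real.continuous_mul_log.tendsto _).comp (hlimα α))
    simp only [mul_sub]
    refine ge_of_tendsto' h1 fun k => ?_
    -- Stationarity in the direction of the minimizer itself: `log c - log ν = -p ⬝ᵥ y`, so the
    -- entropy sum equals `2 ε (y ⬝ᵥ y) ≥ 0`. It passes to the limit because `x log x` is
    -- continuous, also at `0`.
    have h2 := hy2 (φ k) (y (φ k))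
    have h3 : ∑ α, (ν (φ k) α * Real.log (c α) - ν (φ k) α * Real.log (ν (φ k) α)) =
        - ∑ α, c α * Real.exp (p α ⬝ᵥ y (φ k)) * (p α ⬝ᵥ y (φ k)) := by
      rw [← Finset.sum_neg_distrib]
      refine Finset.sum_congr rfl fun α _ => ?_
      rcases (hc α).eq_or_lt with h | h
      · simp [hν, ← h]
      · simp only [hν]
        rw [Real.log_mul h.ne' (Real.exp_pos _).ne', Real.log_exp]
        ring
    have h4 : 0 ≤ 2 * (1 / ((φ k : ℝ) + 1)) * (y (φ k) ⬝ᵥ y (φ k)) :=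
      mul_nonneg (by positivity) (hyy _)
    rw [h3]
    linarith

end Sonc

/-! ### Barycentric coordinates and decomposition into circuits. -/

namespace Sonc

variable {n : ℕ}

open Classical in
/-- The barycentric coordinates of an interior point `β` of the simplex with vertex set `Δ`,
extended by zero. -/
noncomputable def bary (Δ : Finset (Fin n →₀ ℕ)) (β : Fin n →₀ ℕ) (α : Fin n →₀ ℕ) : ℝ :=
  if h : InSimplexInterior Δ β ∧ α ∈ Δ then h.1.choose α else 0

lemma bary_eq_zero {Δ : Finset (Fin n →₀ ℕ)} {β α : Fin n →₀ ℕ} (h : α ∉ Δ) :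
    bary Δ β α = 0 := by
  simp [bary, h]

section

variable {Δ : Finset (Fin n →₀ ℕ)} {β : Fin n →₀ ℕ} (h : InSimplexInterior Δ β)
include h

lemma bary_pos {α : Fin n →₀ ℕ} (hα : α ∈ Δ) : 0 < bary Δ β α := by
  rw [bary, dif_pos ⟨h, hα⟩]
  exact h.choose_spec.1 α hα

lemma sum_bary : ∑ α ∈ Δ, bary Δ β α = 1 := by
  rw [← h.choose_spec.2.1]
  exact Finset.sum_congr rfl fun α hα => by rw [bary, dif_pos ⟨h, hα⟩]

lemma sum_bary_smul : ∑ α ∈ Δ, bary Δ β α • toReal α = toReal β := by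
  conv_rhs => rw [h.choose_spec.2.2]
  exact Finset.sum_congr rfl fun α hα => by rw [bary, dif_pos ⟨h, hα⟩]

end

lemma bary_nonneg (Δ : Finset (Fin n →₀ ℕ)) (β α : Fin n →₀ ℕ) : 0 ≤ bary Δ β α := by
  by_cases h : InSimplexInterior Δ β ∧ α ∈ Δ
  · exact (bary_pos h.1 h.2).le
  · rw [bary, dif_neg h]

lemma IsSimplexVertices.eq_zero_of_sum {Δ : Finset (Fin n →₀ ℕ)} (h : IsSimplexVertices Δ)
    {k : (Fin n →₀ ℕ) → ℝ} (h0 : ∑ α ∈ Δ, k α = 0) (h1 : ∑ α ∈ Δ, k α • toReal α = 0)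
    {α : Fin n →₀ ℕ} (hα : α ∈ Δ) : k α = 0 := by
  have := affineIndependent_iff.1 h.2 Finset.univ (fun α => k α)
    (by rw [Finset.sum_coe_sort Δ k, h0])
    (by rw [Finset.sum_coe_sort Δ (fun α => k α • toReal α), h1])
  exact this ⟨α, hα⟩ (Finset.mem_univ _)

lemma eq_bary {Δ : Finset (Fin n →₀ ℕ)} {β : Fin n →₀ ℕ} (hΔ : IsSimplexVertices Δ)
    (h : InSimplexInterior Δ β) {k : (Fin n →₀ ℕ) → ℝ} (h0 : ∑ α ∈ Δ, k α = 1)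
    (h1 : ∑ α ∈ Δ, k α • toReal α = toReal β) {α : Fin n →₀ ℕ} (hα : α ∈ Δ) :
    k α = bary Δ β α := by
  refine sub_eq_zero.1 (hΔ.eq_zero_of_sum (k := fun α => k α - bary Δ β α) ?_ ?_ hα)
  · rw [Finset.sum_sub_distrib, h0, sum_bary h, sub_self]
  · simp only [sub_smul]
    rw [Finset.sum_sub_distrib, h1, sum_bary_smul h, sub_self]

open Classical in
/-- The simplices with vertices in `Λ` that contain `β` in their interior. -/
noncomputable def simplicesIn (Λ : Finset (Fin n →₀ ℕ)) (β : Fin n →₀ ℕ) :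
    Finset (Finset (Fin n →₀ ℕ)) :=
  Λ.powerset.filter (fun Δ => IsSimplexVertices Δ ∧ InSimplexInterior Δ β)

lemma mem_simplicesIn {Λ Δ : Finset (Fin n →₀ ℕ)} {β : Fin n →₀ ℕ} :
    Δ ∈ simplicesIn Λ β ↔ Δ ⊆ Λ ∧ IsSimplexVertices Δ ∧ InSimplexInterior Δ β := by
  simp [simplicesIn]

lemma simplices_eq (f : MvPolynomial (Fin n) ℝ) (β : Fin n →₀ ℕ) :
    simplices f β = simplicesIn (Lam f) β := rfl

/-- Carathéodory's theorem: a nontrivial positive relation is supported by a simplex. -/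
lemma exists_simplex_of_relation {Λ : Finset (Fin n →₀ ℕ)} {β : Fin n →₀ ℕ}
    {ν : (Fin n →₀ ℕ) → ℝ} (hν : ∀ α ∈ Λ, 0 < ν α) (hΛ : Λ.Nonempty)
    (h0 : ∑ α ∈ Λ, ν α • (toReal α - toReal β) = 0) : (simplicesIn Λ β).Nonempty := by
  have hs : 0 < ∑ α ∈ Λ, ν α := Finset.sum_pos hν hΛ
  have hmem : toReal β ∈ convexHull ℝ (toReal '' (Λ : Set (Fin n →₀ ℕ))) := by
    have h1 : ∑ α ∈ Λ, (ν α / ∑ α ∈ Λ, ν α) • toReal α = toReal β := by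
      simp only [smul_sub, Finset.sum_sub_distrib, ← Finset.sum_smul] at h0
      simp only [div_eq_inv_mul, mul_smul]
      rw [← Finset.smul_sum, sub_eq_zero.1 h0, smul_smul, inv_mul_cancel₀ hs.ne', one_smul]
    rw [← h1]
    refine (convex_convexHull ℝ _).sum_mem (fun α hα => (div_pos (hν α hα) hs).le) ?_
      fun α hα => subset_convexHull ℝ _ ⟨α, hα, rfl⟩
    rw [← Finset.sum_div, div_self hs.ne']
  obtain ⟨ι, _, z, w, hz, hind, hw, hw1, hwz⟩ := eq_pos_convex_span_of_mem_convexHull hmem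
  have hex : ∀ i, ∃ α ∈ Λ, toReal α = z i := fun i => hz ⟨i, rfl⟩
  choose a haΛ haz using hex
  have hinj : Function.Injective a := by
    intro i j hij
    apply hind.injective
    rw [← haz, ← haz, hij]
  refine ⟨Finset.univ.map ⟨a, hinj⟩, mem_simplicesIn.2 ⟨?_, ⟨?_, ?_⟩, Function.extend a w 0, ?_⟩⟩
  · intro α hα
    obtain ⟨i, -, rfl⟩ := Finset.mem_map.1 hα
    exact haΛ i
  · rw [Finset.map_nonempty, Finset.univ_nonempty_iff]
    by_contra hne
    rw [not_nonempty_iff] at hne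
    simp at hw1
  · have hpre : ∀ α : (Finset.univ.map ⟨a, hinj⟩ : Finset (Fin n →₀ ℕ)), ∃ i, a i = α := by
      intro α
      obtain ⟨i, -, hi⟩ := Finset.mem_map.1 α.2
      exact ⟨i, hi⟩
    choose e he using hpre
    have hei : Function.Injective e := fun x y hxy => by
      apply Subtype.ext
      rw [← he, ← he, hxy]
    have := hind.comp_embedding ⟨e, hei⟩
    have hz' : z ∘ e = fun α : (Finset.univ.map ⟨a, hinj⟩ : Finset (Fin n →₀ ℕ)) =>
        toReal (α : Fin n →₀ ℕ) := by
      funext α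
      simp [← haz, he]
    rwa [Function.Embedding.coeFn_mk, hz'] at this
  · refine ⟨fun α hα => ?_, ?_, ?_⟩
    · obtain ⟨i, -, rfl⟩ := Finset.mem_map.1 hα
      simpa [hinj.extend_apply] using hw i
    · simpa [hinj.extend_apply] using hw1
    · simp [hinj.extend_apply, haz, hwz]

/-- A nonnegative relation is a nonnegative combination of barycentric ones. -/
lemma exists_conformal_decomposition (Λ : Finset (Fin n →₀ ℕ)) (β : Fin n →₀ ℕ)
    (ν : (Fin n →₀ ℕ) → ℝ) (hν : ∀ α ∈ Λ, 0 ≤ ν α)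
    (h0 : ∑ α ∈ Λ, ν α • (toReal α - toReal β) = 0) :
    ∃ N : Finset (Fin n →₀ ℕ) → ℝ, (∀ Δ, 0 ≤ N Δ) ∧
      ∀ α ∈ Λ, ν α = ∑ Δ ∈ simplicesIn Λ β, N Δ * bary Δ β α := by
  classical
  induction hk : (Λ.filter (fun α => ν α ≠ 0)).card using Nat.strong_induction_on
    generalizing ν with
  | _ k ih =>
  subst hk
  rcases (Λ.filter (fun α => ν α ≠ 0)).eq_empty_or_nonempty with he | hne
  · refine ⟨0, fun _ => le_rfl, fun α hα => ?_⟩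
    have := Finset.filter_eq_empty_iff.1 he hα
    simpa using this
  set W := Λ.filter (fun α => ν α ≠ 0) with hW
  have hWΛ : W ⊆ Λ := Finset.filter_subset _ _
  have hWpos : ∀ α ∈ W, 0 < ν α := fun α hα =>
    lt_of_le_of_ne (hν α (hWΛ hα)) (Ne.symm (Finset.mem_filter.1 hα).2)
  have h0W : ∑ α ∈ W, ν α • (toReal α - toReal β) = 0 := by
    rw [← h0]
    refine Finset.sum_subset hWΛ fun α hα hα' => ?_
    have : ν α = 0 := by
      by_contra h
      exact hα' (Finset.mem_filter.2 ⟨hα, h⟩)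
    rw [this, zero_smul]
  obtain ⟨Δ, hΔ⟩ := exists_simplex_of_relation hWpos hne h0W
  obtain ⟨hΔW, hΔs, hΔi⟩ := mem_simplicesIn.1 hΔ
  have hΔΛ : Δ ∈ simplicesIn Λ β := mem_simplicesIn.2 ⟨hΔW.trans hWΛ, hΔs, hΔi⟩
  -- Ratio test: `m` is the largest multiple of the barycentric relation of `Δ` that can be
  -- subtracted; it annihilates the weight at `α₀`, so the support shrinks.
  obtain ⟨α₀, hα₀, hmin⟩ := Δ.exists_min_image (fun α => ν α / bary Δ β α) hΔs.1
  set m := ν α₀ / bary Δ β α₀ with hm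
  have hm0 : 0 ≤ m := div_nonneg (hWpos _ (hΔW hα₀)).le (bary_nonneg _ _ _)
  set ν' : (Fin n →₀ ℕ) → ℝ := fun α => ν α - m * bary Δ β α with hν'
  have hν'0 : ∀ α ∈ Λ, 0 ≤ ν' α := by
    intro α hα
    by_cases hαΔ : α ∈ Δ
    · have h1 := hmin α hαΔ
      rw [le_div_iff₀ (bary_pos hΔi hαΔ)] at h1
      simp only [hν']
      linarith
    · simpa [hν', bary_eq_zero hαΔ] using hν α hα
  have hrel : ∑ α ∈ Λ, bary Δ β α • (toReal α - toReal β) = 0 := by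
    rw [← Finset.sum_subset (hΔW.trans hWΛ) fun α _ hα => by rw [bary_eq_zero hα, zero_smul]]
    simp only [smul_sub, Finset.sum_sub_distrib, ← Finset.sum_smul]
    rw [sum_bary hΔi, sum_bary_smul hΔi, one_smul, sub_self]
  have hν'r : ∑ α ∈ Λ, ν' α • (toReal α - toReal β) = 0 := by
    simp only [hν', sub_smul, mul_smul, Finset.sum_sub_distrib, ← Finset.smul_sum]
    rw [h0, hrel, smul_zero, sub_zero]
  have hlt : (Λ.filter (fun α => ν' α ≠ 0)).card < W.card := by
    refine Finset.card_lt_card (Finset.ssubset_iff_subset_ne.2 ⟨fun α hα => ?_, fun he => ?_⟩)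
    · obtain ⟨h1, h2⟩ := Finset.mem_filter.1 hα
      by_contra h3
      have h4 : ν α = 0 := by
        by_contra h
        exact h3 (Finset.mem_filter.2 ⟨h1, h⟩)
      exact h2 (by simp [hν', h4, bary_eq_zero fun h => h3 (hΔW h)])
    · have h1 := hΔW hα₀
      rw [← he] at h1
      refine (Finset.mem_filter.1 h1).2 ?_
      simp only [hν', hm]
      rw [div_mul_cancel₀ _ (bary_pos hΔi hα₀).ne', sub_self]
  obtain ⟨N, hN0, hN⟩ := ih _ hlt ν' hν'0 hν'r rfl
  refine ⟨fun Γ => N Γ + if Γ = Δ then m else 0, fun Γ => ?_, fun α hα => ?_⟩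
  · refine add_nonneg (hN0 Γ) ?_
    split_ifs
    exacts [hm0, le_rfl]
  · simp only [add_mul, Finset.sum_add_distrib, ite_mul, zero_mul]
    rw [← hN α hα, Finset.sum_ite_eq' _ _ _, if_pos hΔΛ]
    simp [hν']

/-- A nonnegative signomial with positive terms in `Λ` and a negative term at `β` decomposes into
circuit signomials that satisfy the inequality of weighted means. -/
theorem exists_circuit_certificates (Λ : Finset (Fin n →₀ ℕ)) (β : Fin n →₀ ℕ)
    (c : (Fin n →₀ ℕ) → ℝ) (hc : ∀ α ∈ Λ, 0 ≤ c α) {d : ℝ} (hd0 : 0 ≤ d)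
    (hd : ∀ y, d * Real.exp (toReal β ⬝ᵥ y) ≤ ∑ α ∈ Λ, c α * Real.exp (toReal α ⬝ᵥ y)) :
    ∃ (N D : Finset (Fin n →₀ ℕ) → ℝ) (s : (Fin n →₀ ℕ) → ℝ), (∀ Δ, 0 ≤ N Δ) ∧ (∀ Δ, 0 ≤ D Δ) ∧
      (∀ Δ, D Δ ≤ N Δ * Real.exp (∑ α ∈ Δ, bary Δ β α * s α)) ∧
      ∑ Δ ∈ simplicesIn Λ β, D Δ = d ∧
      ∀ α ∈ Λ, ∑ Δ ∈ simplicesIn Λ β, N Δ * bary Δ β α * Real.exp (s α) ≤ c α := by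
  classical
  obtain ⟨μ, hμ0, hμc, hμr, hμd, hμe⟩ := exists_entropy_certificate
    (fun α : Λ => toReal (α : Fin n →₀ ℕ) - toReal β) (fun α => c α) (fun α => hc α α.2) d (by
      intro y
      have h1 : ∀ α : Fin n →₀ ℕ, c α * Real.exp ((toReal α - toReal β) ⬝ᵥ y) =
          c α * Real.exp (toReal α ⬝ᵥ y) / Real.exp (toReal β ⬝ᵥ y) := by
        intro α
        rw [sub_dotProduct, Real.exp_sub, mul_div_assoc]
      rw [Finset.sum_coe_sort Λ (fun α => c α * Real.exp ((toReal α - toReal β) ⬝ᵥ y)),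
        Finset.sum_congr rfl (fun α _ => h1 α), ← Finset.sum_div,
        le_div_iff₀ (Real.exp_pos _)]
      exact hd y)
  set ν : (Fin n →₀ ℕ) → ℝ := fun α => if h : α ∈ Λ then μ ⟨α, h⟩ else 0 with hν
  have hνμ : ∀ α : Λ, μ α = ν α := fun α => by simp [hν]
  simp only [hνμ] at hμ0 hμc hμr hμd hμe
  rw [Finset.sum_coe_sort Λ (fun α => ν α • (toReal α - toReal β))] at hμr
  rw [Finset.sum_coe_sort Λ ν] at hμd
  rw [Finset.sum_coe_sort Λ (fun α => ν α * (Real.log (c α) - Real.log (ν α)))] at hμe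
  have hν0 : ∀ α ∈ Λ, 0 ≤ ν α := fun α hα => hμ0 ⟨α, hα⟩
  obtain ⟨N, hN0, hN⟩ := exists_conformal_decomposition Λ β ν hν0 hμr
  -- This choice makes `ν α * exp (s α) = c α` wherever `ν α > 0`. Where `ν α = 0` the value is
  -- irrelevant, since all terms carry the factor `ν α`.
  set s : (Fin n →₀ ℕ) → ℝ := fun α => Real.log (c α) - Real.log (ν α) with hs
  set E : Finset (Fin n →₀ ℕ) → ℝ := fun Δ =>
    N Δ * Real.exp (∑ α ∈ Δ, bary Δ β α * s α) with hE
  set B := ∑ Δ ∈ simplicesIn Λ β, E Δ with hB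
  have hE0 : ∀ Δ, 0 ≤ E Δ := fun Δ => mul_nonneg (hN0 Δ) (Real.exp_pos _).le
  have hB0 : 0 ≤ B := Finset.sum_nonneg fun Δ _ => hE0 Δ
  have hext : ∀ g : (Fin n →₀ ℕ) → ℝ, ∑ Δ ∈ simplicesIn Λ β, N Δ * ∑ α ∈ Δ, bary Δ β α * g α =
      ∑ α ∈ Λ, ν α * g α := by
    intro g
    have h1 : ∀ Δ ∈ simplicesIn Λ β, N Δ * ∑ α ∈ Δ, bary Δ β α * g α =
        ∑ α ∈ Λ, N Δ * bary Δ β α * g α := by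
      intro Δ hΔ
      rw [Finset.sum_subset (mem_simplicesIn.1 hΔ).1 fun α _ hα => by
        rw [bary_eq_zero hα, zero_mul], Finset.mul_sum]
      exact Finset.sum_congr rfl fun α _ => by ring
    rw [Finset.sum_congr rfl h1, Finset.sum_comm]
    refine Finset.sum_congr rfl fun α hα => ?_
    rw [hN α hα, Finset.sum_mul]
  -- By `exp x ≥ 1 + x`, `B` is at least `∑ ν + ∑ ν (log c - log ν)`; the first sum is at least `d`
  -- and the second is nonnegative.
  have hdB : d ≤ B := by
    have h1 : ∀ Δ ∈ simplicesIn Λ β,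
        N Δ * ∑ α ∈ Δ, bary Δ β α * 1 + N Δ * ∑ α ∈ Δ, bary Δ β α * s α ≤ E Δ := by
      intro Δ hΔ
      simp only [mul_one, sum_bary (mem_simplicesIn.1 hΔ).2.2]
      have := mul_le_mul_of_nonneg_left
        (Real.add_one_le_exp (∑ α ∈ Δ, bary Δ β α * s α)) (hN0 Δ)
      simp only [hE]
      linarith
    have h2 := Finset.sum_le_sum h1
    rw [Finset.sum_add_distrib, hext, hext] at h2
    simp only [mul_one] at h2
    linarith
  refine ⟨N, fun Δ => d / B * E Δ, s, hN0, fun Δ => mul_nonneg (div_nonneg hd0 hB0) (hE0 Δ),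
    fun Δ => ?_, ?_, fun α hα => ?_⟩
  · exact mul_le_of_le_one_left (hE0 Δ) (div_le_one_of_le₀ hdB hB0)
  · rw [← Finset.mul_sum]
    -- If `B = 0` then `0 ≤ d ≤ B` forces `d = 0`, consistent with `d / 0 = 0`.
    rcases hB0.eq_or_lt with h | h
    · rw [← hB, ← h]
      linarith
    · exact div_mul_cancel₀ d h.ne'
  · rw [← Finset.sum_mul, ← hN α hα]
    rcases (hν0 α hα).eq_or_lt with h | h
    · rw [← h, zero_mul]
      exact hc α hα
    · have hcα : 0 < c α := lt_of_le_of_ne (hc α hα) fun h1 =>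
        h.ne' (hμc ⟨α, hα⟩ h1.symm)
      simp only [hs]
      rw [Real.exp_sub, Real.exp_log hcα, Real.exp_log h, mul_div_cancel₀ _ h.ne']

end Sonc

/-! ### Sums of AGE signomials without cancellation. -/

namespace Sonc

/-- The coefficient function `h` belongs to a signomial with exponents in `S` and at most one
term, the one at `β`, that is not a positive multiple of an even one, and which is nonnegative
for all choices of signs. Here `ev y α` is the value of the monomial `α` at the point `y`. -/
def IsAGE {I Y : Type*} (ev : Y → I → ℝ) (Ev : Set I) (S : Finset I) (β : I) (h : I → ℝ) :
    Prop :=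
  (∀ α, α ≠ β → 0 ≤ h α) ∧ (∀ α, α ≠ β → α ∉ Ev → h α = 0) ∧ (∀ α, α ∉ S → h α = 0) ∧
    ∀ y, (0 ≤ ∑ α ∈ S, h α * ev y α) ∧
      (β ∉ Ev → 2 * h β * ev y β ≤ ∑ α ∈ S, h α * ev y α)

variable {I Y : Type*} {ev : Y → I → ℝ} {Ev : Set I} {S : Finset I}

lemma IsAGE.zero (β : I) : IsAGE ev Ev S β 0 := by
  simp [IsAGE]

lemma IsAGE.add {β : I} {g h : I → ℝ} (hg : IsAGE ev Ev S β g) (hh : IsAGE ev Ev S β h) :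
    IsAGE ev Ev S β (g + h) := by
  obtain ⟨g1, g2, g3, g4⟩ := hg
  obtain ⟨h1, h2, h3, h4⟩ := hh
  refine ⟨fun α ha => add_nonneg (g1 α ha) (h1 α ha), fun α ha he => ?_, fun α ha => ?_,
    fun y => ?_⟩
  · simp [g2 α ha he, h2 α ha he]
  · simp [g3 α ha, h3 α ha]
  · simp only [Pi.add_apply, add_mul, Finset.sum_add_distrib]
    refine ⟨add_nonneg (g4 y).1 (h4 y).1, fun hb => ?_⟩
    have := (g4 y).2 hb
    have := (h4 y).2 hb
    linarith

lemma IsAGE.smul {β : I} {g : I → ℝ} (hg : IsAGE ev Ev S β g) {m : ℝ} (hm : 0 ≤ m) :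
    IsAGE ev Ev S β (m • g) := by
  obtain ⟨g1, g2, g3, g4⟩ := hg
  refine ⟨fun α ha => mul_nonneg hm (g1 α ha), fun α ha he => by simp [g2 α ha he],
    fun α ha => by simp [g3 α ha], fun y => ?_⟩
  have e : ∑ α ∈ S, (m • g) α * ev y α = m * ∑ α ∈ S, g α * ev y α := by
    rw [Finset.mul_sum]
    exact Finset.sum_congr rfl fun α _ => by simp [mul_assoc]
  rw [e]
  refine ⟨mul_nonneg hm (g4 y).1, fun hb => ?_⟩
  have := mul_le_mul_of_nonneg_left ((g4 y).2 hb) hm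
  simp only [Pi.smul_apply, smul_eq_mul]
  linarith

/-- An AGE signomial at `β` absorbs one at an even exponent `γ`, provided that the coefficient at
`γ` stays nonnegative. -/
lemma IsAGE.add_smul_of_ne {β γ : I} {g h : I → ℝ} (hg : IsAGE ev Ev S β g)
    (hh : IsAGE ev Ev S γ h) (hγ : γ ∈ Ev) (hβ : β ≠ γ) {m : ℝ} (hm : 0 ≤ m)
    (hpos : 0 ≤ g γ + m * h γ) : IsAGE ev Ev S β (g + m • h) := by
  obtain ⟨g1, g2, g3, g4⟩ := hg
  obtain ⟨h1, h2, h3, h4⟩ := hh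
  refine ⟨fun α ha => ?_, fun α ha he => ?_, fun α ha => by simp [g3 α ha, h3 α ha],
    fun y => ?_⟩
  · by_cases hαγ : α = γ
    · subst hαγ; simpa using hpos
    · exact add_nonneg (g1 α ha) (mul_nonneg hm (h1 α hαγ))
  · have hαγ : α ≠ γ := fun e => he (e ▸ hγ)
    simp [g2 α ha he, h2 α hαγ he]
  · have e : ∑ α ∈ S, (g + m • h) α * ev y α =
        ∑ α ∈ S, g α * ev y α + m * ∑ α ∈ S, h α * ev y α := by
      rw [Finset.mul_sum, ← Finset.sum_add_distrib]
      exact Finset.sum_congr rfl fun α _ => by simp; ring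
    rw [e]
    have h5 := mul_nonneg hm (h4 y).1
    refine ⟨add_nonneg (g4 y).1 h5, fun hb => ?_⟩
    have := (g4 y).2 hb
    simp only [Pi.add_apply, Pi.smul_apply, h2 β hβ hb, smul_zero, add_zero]
    linarith

lemma IsAGE.mono {β : I} {g : I → ℝ} (hg : IsAGE ev Ev S β g) {S' : Finset I} (hS : S ⊆ S') :
    IsAGE ev Ev S' β g := by
  obtain ⟨g1, g2, g3, g4⟩ := hg
  refine ⟨g1, g2, fun α ha => g3 α fun h => ha (hS h), fun y => ?_⟩
  rw [← Finset.sum_subset hS fun α _ ha => by rw [g3 α ha, zero_mul]]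
  exact g4 y

/-- The sums of AGE signomials. -/
def ageCone {I Y : Type*} (ev : Y → I → ℝ) (Ev : Set I) : AddSubmonoid (I → ℝ) where
  carrier := {F | ∃ (S : Finset I) (h : I → I → ℝ), (∀ β ∈ S, IsAGE ev Ev S β (h β)) ∧
    ∀ α, F α = ∑ β ∈ S, h β α}
  zero_mem' := ⟨∅, 0, by simp, by simp⟩
  add_mem' := by
    classical
    rintro F G ⟨S, h, h1, h2⟩ ⟨T, k, k1, k2⟩
    refine ⟨S ∪ T, fun β => (if β ∈ S then h β else 0) + if β ∈ T then k β else 0,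
      fun β _ => ?_, fun α => ?_⟩
    · refine IsAGE.add ?_ ?_
      · split_ifs with hβ
        exacts [(h1 β hβ).mono Finset.subset_union_left, IsAGE.zero β]
      · split_ifs with hβ
        exacts [(k1 β hβ).mono Finset.subset_union_right, IsAGE.zero β]
    · simp only [Pi.add_apply, Finset.sum_add_distrib]
      rw [h2, k2]
      congr 1
      · rw [← Finset.sum_subset Finset.subset_union_left fun β _ hβ => by simp [hβ]]
        exact Finset.sum_congr rfl fun β hβ => by rw [if_pos hβ]
      · rw [← Finset.sum_subset Finset.subset_union_right fun β _ hβ => by simp [hβ]]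
        exact Finset.sum_congr rfl fun β hβ => by rw [if_pos hβ]

lemma IsAGE.mem_ageCone {β : I} {g : I → ℝ} (hg : IsAGE ev Ev S β g) (hβ : β ∈ S) :
    g ∈ ageCone ev Ev := by
  classical
  refine ⟨S, fun γ => if γ = β then g else 0, fun γ _ => ?_, fun α => ?_⟩
  · by_cases h : γ = β
    · subst h
      simpa using hg
    · simpa [h] using IsAGE.zero γ
  · rw [Finset.sum_eq_single β (fun γ _ hne => by simp [hne]) (fun h => absurd hβ h)]
    simp

/-- The family `h` of signomials has no cancellation at the exponent `γ` of its sum `F`. -/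
def NoCancellationAt (Ev : Set I) (F : I → ℝ) (h : I → I → ℝ) (S : Finset I) (γ : I) : Prop :=
  (γ ∈ Ev ∧ 0 < F γ → 0 ≤ h γ γ) ∧ (¬ (γ ∈ Ev ∧ 0 < F γ) → ∀ β ∈ S, β ≠ γ → h β γ = 0)

/-- If `h γ` is negative at an even `γ` while other summands are positive there, then `h γ` is
distributed among those summands in proportion to their coefficients at `γ`. The last clause, that
exponents already treated stay free of cancellation, allows treating the exponents one by one. -/
lemma exists_noCancellationAt [DecidableEq I] {F : I → ℝ} {h : I → I → ℝ}
    (hh : ∀ β ∈ S, IsAGE ev Ev S β (h β)) (hF : ∀ α, F α = ∑ β ∈ S, h β α) {γ : I}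
    (hγ : γ ∈ S) :
    ∃ h' : I → I → ℝ, (∀ β ∈ S, IsAGE ev Ev S β (h' β)) ∧ (∀ α, F α = ∑ β ∈ S, h' β α) ∧
      NoCancellationAt Ev F h' S γ ∧
      ∀ δ ∈ S, NoCancellationAt Ev F h S δ → NoCancellationAt Ev F h' S δ := by
  have hnn : ∀ β ∈ S.erase γ, 0 ≤ h β γ := fun β hβ =>
    (hh β (Finset.mem_of_mem_erase hβ)).1 γ (Finset.ne_of_mem_erase hβ).symm
  set s := ∑ β ∈ S.erase γ, h β γ with hs
  have hs0 : 0 ≤ s := Finset.sum_nonneg hnn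
  have hFγ : F γ = h γ γ + s := by rw [hF, ← Finset.add_sum_erase S _ hγ]
  have hzero : s = 0 → ∀ β ∈ S, β ≠ γ → h β γ = 0 := fun h0 β hβ hne =>
    (Finset.sum_eq_zero_iff_of_nonneg hnn).1 h0 β (Finset.mem_erase.2 ⟨hne, hβ⟩)
  by_cases hEv : γ ∈ Ev
  swap
  · refine ⟨h, hh, hF, ⟨fun h1 => absurd h1.1 hEv, fun _ β hβ hne => ?_⟩, fun δ _ h => h⟩
    exact (hh β hβ).2.1 γ hne.symm hEv
  rcases hs0.eq_or_lt with hs1 | hs1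
  · refine ⟨h, hh, hF, ⟨fun h1 => ?_, fun _ => hzero hs1.symm⟩, fun δ _ h => h⟩
    linarith [h1.2]
  by_cases hx : 0 ≤ h γ γ
  · refine ⟨h, hh, hF, ⟨fun _ => hx, fun h1 => absurd ⟨hEv, ?_⟩ h1⟩, fun δ _ h => h⟩
    linarith
  push Not at hx
  -- Summand `β` receives the fraction `h β γ / m` of `h γ`. If `F γ > 0` then `m = s` and `h γ` is
  -- used up; otherwise `m = -h γ γ` and all other summands vanish at `γ`. In both cases no
  -- coefficient at `γ` becomes negative.
  set m := max s (-h γ γ) with hm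
  have hm0 : 0 < m := lt_of_lt_of_le hs1 (le_max_left _ _)
  have hsm : s / m ≤ 1 := (div_le_one hm0).2 (le_max_left _ _)
  set h' : I → I → ℝ := fun β => if β = γ then (1 - s / m) • h γ
    else h β + (h β γ / m) • h γ with hh'
  have hγ' : h' γ = (1 - s / m) • h γ := by simp [hh']
  have hne' : ∀ β, β ≠ γ → h' β = h β + (h β γ / m) • h γ := fun β hβ => by simp [hh', hβ]
  have hnn' : ∀ β ∈ S, β ≠ γ → 0 ≤ h β γ / m := fun β hβ hne =>
    div_nonneg (hnn β (Finset.mem_erase.2 ⟨hne, hβ⟩)) hm0.le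
  refine ⟨h', fun β hβ => ?_, fun α => ?_, ⟨fun h1 => ?_, fun h1 β hβ hne => ?_⟩,
    fun δ hδ hcan => ?_⟩
  · by_cases hβγ : β = γ
    · rw [hβγ, hγ']
      exact (hh γ hγ).smul (by linarith)
    · rw [hne' β hβγ]
      refine (hh β hβ).add_smul_of_ne (hh γ hγ) hEv hβγ (hnn' β hβ hβγ) ?_
      have h1 : h β γ + h β γ / m * h γ γ = h β γ / m * (m + h γ γ) := by
        field_simp
      rw [h1]
      refine mul_nonneg (hnn' β hβ hβγ) ?_
      linarith [le_max_right s (-h γ γ)]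
  · have h1 : ∑ β ∈ S.erase γ, h' β α = ∑ β ∈ S.erase γ, h β α + s / m * h γ α := by
      rw [hs, Finset.sum_div, Finset.sum_mul, ← Finset.sum_add_distrib]
      refine Finset.sum_congr rfl fun β hβ => ?_
      rw [hne' β (Finset.ne_of_mem_erase hβ)]
      simp
    rw [hF, ← Finset.add_sum_erase S _ hγ, ← Finset.add_sum_erase S (fun β => h' β α) hγ, h1,
      hγ']
    simp only [Pi.smul_apply, smul_eq_mul]
    ring
  · have h2 : m = s := max_eq_left (by linarith [h1.2])
    rw [hγ', h2, div_self hs1.ne']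
    simp
  · have h2 : m = -h γ γ := max_eq_right (by
      by_contra h3
      exact h1 ⟨hEv, by linarith⟩)
    rw [hne' β hne]
    simp only [Pi.add_apply, Pi.smul_apply, smul_eq_mul, h2]
    have := hx.ne
    field_simp
    ring
  · by_cases hδγ : δ = γ
    · subst hδγ
      refine ⟨fun h1 => ?_, fun h1 β hβ hne => ?_⟩
      · linarith [hcan.1 h1]
      · rw [hne' β hne]
        simp [hcan.2 h1 β hβ hne]
    · refine ⟨fun h1 => ?_, fun h1 β hβ hne => ?_⟩
      · rw [hne' δ hδγ]
        exact add_nonneg (hcan.1 h1) (mul_nonneg (hnn' δ hδ hδγ) ((hh γ hγ).1 δ hδγ))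
      · have h2 : h γ δ = 0 := hcan.2 h1 γ hγ (Ne.symm hδγ)
        by_cases hβγ : β = γ
        · subst hβγ
          rw [hγ']
          simp [h2]
        · rw [hne' β hβγ]
          simp [h2, hcan.2 h1 β hβ hne]

/-- Every sum of AGE signomials has a decomposition without cancellation. -/
lemma exists_forall_noCancellationAt [DecidableEq I] {F : I → ℝ} {h : I → I → ℝ}
    (hh : ∀ β ∈ S, IsAGE ev Ev S β (h β)) (hF : ∀ α, F α = ∑ β ∈ S, h β α) :
    ∃ h' : I → I → ℝ, (∀ β ∈ S, IsAGE ev Ev S β (h' β)) ∧ (∀ α, F α = ∑ β ∈ S, h' β α) ∧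
      ∀ γ ∈ S, NoCancellationAt Ev F h' S γ := by
  suffices H : ∀ T : Finset I, T ⊆ S → ∃ h' : I → I → ℝ, (∀ β ∈ S, IsAGE ev Ev S β (h' β)) ∧
      (∀ α, F α = ∑ β ∈ S, h' β α) ∧ ∀ γ ∈ T, NoCancellationAt Ev F h' S γ from
    H S subset_rfl
  intro T
  induction T using Finset.induction_on with
  | empty => exact fun _ => ⟨h, hh, hF, by simp⟩
  | insert γ T hγ ih =>
    intro hT
    obtain ⟨g, hg1, hg2, hg3⟩ := ih fun x hx => hT (Finset.mem_insert_of_mem hx)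
    obtain ⟨g', h1, h2, h3, h4⟩ :=
      exists_noCancellationAt hg1 hg2 (hT (Finset.mem_insert_self γ T))
    refine ⟨g', h1, h2, fun δ hδ => ?_⟩
    rcases Finset.mem_insert.1 hδ with rfl | hδ'
    · exact h3
    · exact h4 δ (hT hδ) (hg3 δ hδ')

/-- Cancellation-free decompositions of sums of AGE signomials: the coefficients at `Λ`, the even
exponents with positive coefficients, are distributed among the remaining exponents `Γ`. -/
theorem exists_distribution_of_mem_ageCone [DecidableEq I] {F : I → ℝ}
    (hF : F ∈ ageCone ev Ev)
    (Λ Γ : Finset I) (hΛ : ∀ α, α ∈ Λ ↔ α ∈ Ev ∧ 0 < F α)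
    (hΓ : ∀ α, α ∈ Γ ↔ F α ≠ 0 ∧ α ∉ Λ) :
    ∃ c : I → I → ℝ, (∀ β ∈ Γ, ∀ α ∈ Λ, 0 ≤ c β α) ∧ (∀ α ∈ Λ, ∑ β ∈ Γ, c β α ≤ F α) ∧
      ∀ β ∈ Γ, ∀ y, |F β| * ev y β ≤ ∑ α ∈ Λ, c β α * ev y α := by
  obtain ⟨S, h, hh, hF⟩ := hF
  obtain ⟨g, hg, hgF, hgc⟩ := exists_forall_noCancellationAt hh hF
  have hFS : ∀ α, F α ≠ 0 → α ∈ S := by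
    intro α hα
    by_contra hS
    exact hα ((hgF α).trans (Finset.sum_eq_zero fun β hβ => (hg β hβ).2.2.1 α hS))
  have hΓS : Γ ⊆ S := fun β hβ => hFS β ((hΓ β).1 hβ).1
  have hΛS : Λ ⊆ S := fun α hα => hFS α ((hΛ α).1 hα).2.ne'
  have hoff : ∀ γ, γ ∉ Λ → ∀ β ∈ S, β ≠ γ → g β γ = 0 := by
    intro γ hγ β hβ hne
    by_cases hS : γ ∈ S
    · exact (hgc γ hS).2 (fun h => hγ ((hΛ γ).2 h)) β hβ hne
    · exact (hg β hβ).2.2.1 γ hS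
  have hdiag : ∀ β ∈ S, β ∉ Λ → g β β = F β := by
    intro β hβ hβΛ
    rw [hgF, Finset.sum_eq_single β (fun γ hγ hne => hoff β hβΛ γ hγ hne)
      (fun h => absurd hβ h)]
  refine ⟨g, fun β hβ α hα => ?_, fun α hα => ?_, fun β hβ y => ?_⟩
  · refine (hg β (hΓS hβ)).1 α ?_
    rintro rfl
    exact ((hΓ _).1 hβ).2 hα
  · rw [hgF]
    refine Finset.sum_le_sum_of_subset_of_nonneg hΓS fun β hβ _ => ?_
    by_cases hαβ : α = β
    · subst hαβ
      exact (hgc α hβ).1 ((hΛ α).1 hα)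
    · exact (hg β hβ).1 α hαβ
  · have hβΛ : β ∉ Λ := ((hΓ β).1 hβ).2
    have hsum : ∑ α ∈ S, g β α * ev y α = F β * ev y β + ∑ α ∈ Λ, g β α * ev y α := by
      rw [← hdiag β (hΓS hβ) hβΛ, ← Finset.sum_insert (f := fun α => g β α * ev y α) hβΛ]
      refine (Finset.sum_subset (Finset.insert_subset (hΓS hβ) hΛS) fun α _ hα => ?_).symm
      rw [Finset.mem_insert, not_or] at hα
      rw [hoff α hα.2 β (hΓS hβ) (Ne.symm hα.1), zero_mul]
    have h4 := (hg β (hΓS hβ)).2.2.2 y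
    rw [hsum, hdiag β (hΓS hβ) hβΛ] at h4
    -- A positive coefficient outside `Λ` sits at a non-even exponent, where the sign-flipped
    -- inequality applies; for a negative one plain nonnegativity suffices.
    rcases abs_cases (F β) with ⟨h5, h6⟩ | ⟨h5, h6⟩
    · rw [h5]
      have hEv : β ∉ Ev := fun h => hβΛ ((hΛ β).2 ⟨h, lt_of_le_of_ne h6 ((hΓ β).1 hβ).1.symm⟩)
      linarith [h4.2 hEv]
    · rw [h5]
      linarith [h4.1]

end Sonc

/-! ### Existence of odd mediated sets. -/

namespace Sonc

variable {n : ℕ}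

/-- The rational numbers with odd denominators. -/
def oddDen : Subring ℚ where
  carrier := {q | Odd q.den}
  mul_mem' {a b} ha hb := Odd.of_dvd_nat (Odd.mul ha hb) (Rat.mul_den_dvd a b)
  add_mem' {a b} ha hb := Odd.of_dvd_nat (Odd.mul ha hb) (Rat.add_den_dvd a b)
  one_mem' := by simp
  zero_mem' := by simp
  neg_mem' {a} ha := by simpa using ha

lemma int_div_mem_oddDen (k : ℤ) {P : ℕ} (hP : Odd P) : (k : ℚ) / P ∈ oddDen := by
  have h := Rat.den_dvd k P
  rw [Int.natCast_dvd_natCast] at h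
  exact hP.of_dvd_nat (by simpa [Rat.divInt_eq_div] using h)

lemma half_mem_oddDen_iff {q : ℚ} : q / 2 ∈ oddDen ↔ Odd q.den ∧ Even q.num := by
  constructor
  · intro h
    have h1 : q ∈ oddDen := by
      have := oddDen.add_mem h h
      rwa [add_halves] at this
    refine ⟨h1, ?_⟩
    have h2 : (q.num : ℚ) * (q / 2).den = 2 * (q / 2).num * q.den := by
      have e1 := Rat.num_div_den q
      have e2 := Rat.num_div_den (q / 2)
      have d1 : (q.den : ℚ) ≠ 0 := by exact_mod_cast q.den_nz
      have d2 : ((q / 2).den : ℚ) ≠ 0 := by exact_mod_cast (q / 2).den_nz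
      rw [div_eq_iff d1] at e1
      rw [div_eq_iff d2] at e2
      rw [e1, mul_assoc 2, mul_comm, mul_comm _ (q.den : ℚ), mul_left_comm, e2]
      ring
    have h3 : q.num * (q / 2).den = 2 * (q / 2).num * q.den := by exact_mod_cast h2
    have h4 : Even (q.num * (q / 2).den) := by
      rw [h3, mul_assoc]
      exact even_two_mul _
    rcases Int.even_mul.1 h4 with h5 | h5
    · exact h5
    · rw [Int.even_coe_nat] at h5
      exact absurd h (Nat.not_odd_iff_even.2 h5)
  · rintro ⟨h1, k, hk⟩
    have h2 : q / 2 = (k : ℚ) / q.den := by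
      conv_lhs => rw [← Rat.num_div_den q, hk]
      push_cast
      ring
    rw [h2]
    exact int_div_mem_oddDen k h1

/-- The points of `ℚ^n` whose coordinates have odd denominators and even numerators. -/
def evenPoints (n : ℕ) : Set (Fin n → ℚ) := {u | ∀ i, u i / 2 ∈ oddDen}

lemma mem_evenPoints {u : Fin n → ℚ} :
    u ∈ evenPoints n ↔ (∀ i, Odd (u i).den) ∧ ∀ i, Even (u i).num := by
  simp only [evenPoints, Set.mem_ofPred_eq, half_mem_oddDen_iff, forall_and]

lemma toRat_mem_evenPoints {α : Fin n →₀ ℕ} : toRat α ∈ evenPoints n ↔ IsEven α := by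
  rw [mem_evenPoints]
  simp [toRat, IsEven]

lemma toRat_injective : Function.Injective (toRat (n := n)) := by
  intro α β h
  ext i
  have := congrFun h i
  simp only [toRat] at this
  exact_mod_cast this

/-- The affine combination of the points of `Δ` with weights `q`. -/
def ratPoint (Δ : Finset (Fin n →₀ ℕ)) (q : (Fin n →₀ ℕ) → ℚ) : Fin n → ℚ :=
  ∑ α ∈ Δ, q α • toRat α

lemma ratPoint_mem_evenPoints {Δ : Finset (Fin n →₀ ℕ)} (hΔ : ∀ α ∈ Δ, IsEven α)
    {q : (Fin n →₀ ℕ) → ℚ} (hq : ∀ α ∈ Δ, q α ∈ oddDen) : ratPoint Δ q ∈ evenPoints n := by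
  intro i
  rw [ratPoint, Finset.sum_apply, Finset.sum_div]
  refine oddDen.sum_mem fun α hα => ?_
  have := toRat_mem_evenPoints.2 (hΔ α hα) i
  simp only [Pi.smul_apply, smul_eq_mul, mul_div_assoc]
  exact oddDen.mul_mem (hq α hα) this

/-- All points with weights in `(1/P)ℤ` serve at once: a non-vertex has two positive weights, each
at least `1/P`, and shifting `1/P` between them in either direction gives two grid points with this
midpoint. They are even because the vertices are and `P` is odd. -/
lemma exists_mediated_of_odd {Δ : Finset (Fin n →₀ ℕ)} (hΔ : ∀ α ∈ Δ, IsEven α) {P : ℕ}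
    (hP : Odd P) {q : (Fin n →₀ ℕ) → ℚ} (hq0 : ∀ α ∈ Δ, 0 ≤ q α) (hq1 : ∑ α ∈ Δ, q α = 1)
    (hqP : ∀ α ∈ Δ, ∃ z : ℤ, q α * P = z) :
    ∃ M : Finset (Fin n → ℚ), IsRationalMediated Δ M ∧ ratPoint Δ q ∈ M ∧
      (M : Set (Fin n → ℚ)) ⊆ evenPoints n := by
  classical
  have hP0 : (0 : ℚ) < P := by exact_mod_cast hP.pos
  set A : Set ((Fin n →₀ ℕ) → ℚ) := {q | (∀ α ∈ Δ, 0 ≤ q α) ∧ ∑ α ∈ Δ, q α = 1 ∧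
    ∀ α ∈ Δ, ∃ z : ℤ, q α * P = z} with hA
  set M : Finset (Fin n → ℚ) := (Finset.piAntidiag Δ P).image
    fun k => ratPoint Δ fun α => (k α : ℚ) / P with hM
  have hAM : ∀ q ∈ A, ratPoint Δ q ∈ M := by
    rintro q ⟨h0, h1, h2⟩
    choose! z hz using h2
    have hz0 : ∀ α ∈ Δ, 0 ≤ z α := by
      intro α hα
      have : (0 : ℚ) ≤ z α := by
        rw [← hz α hα]
        exact mul_nonneg (h0 α hα) hP0.le
      exact_mod_cast this
    have hzq : ∀ α ∈ Δ, ((z α).toNat : ℚ) = q α * P := by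
      intro α hα
      rw [hz α hα]
      exact_mod_cast Int.toNat_of_nonneg (hz0 α hα)
    refine Finset.mem_image.2 ⟨fun α => if α ∈ Δ then (z α).toNat else 0, ?_, ?_⟩
    · rw [Finset.mem_piAntidiag]
      refine ⟨?_, fun α hα => ?_⟩
      · have : (∑ α ∈ Δ, (if α ∈ Δ then (z α).toNat else 0 : ℕ) : ℚ) = P := by
          rw [Finset.sum_congr rfl fun α hα => by rw [if_pos hα, hzq α hα], ← Finset.sum_mul,
            h1, one_mul]
        exact_mod_cast this
      · by_contra h
        simp [h] at hα
    · refine Finset.sum_congr rfl fun α hα => ?_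
      simp only [if_pos hα, hzq α hα]
      rw [mul_div_cancel_right₀ _ hP0.ne']
  have hMA : ∀ u ∈ M, ∃ q ∈ A, ratPoint Δ q = u := by
    intro u hu
    obtain ⟨k, hk, rfl⟩ := Finset.mem_image.1 hu
    refine ⟨_, ⟨fun α _ => by positivity, ?_, fun α _ => ⟨k α, ?_⟩⟩, rfl⟩
    · rw [← Finset.sum_div, div_eq_one_iff_eq hP0.ne']
      exact_mod_cast (Finset.mem_piAntidiag.1 hk).1
    · simp [div_mul_cancel₀ _ hP0.ne']
  refine ⟨M, ⟨fun u hu => ?_, fun u hu => ?_⟩, hAM q ⟨hq0, hq1, hqP⟩, fun u hu => ?_⟩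
  · obtain ⟨α, hα, rfl⟩ := Finset.mem_image.1 hu
    have h1 : ratPoint Δ (Pi.single α 1) = toRat α := by
      rw [ratPoint, Finset.sum_eq_single α (fun γ _ hne => by simp [hne])
        (fun h => absurd hα h)]
      simp
    rw [← h1]
    refine hAM _ ⟨fun γ _ => ?_, ?_, fun γ _ => ?_⟩
    · by_cases h : γ = α
      · subst h; simp
      · simp [h]
    · simp [hα]
    · by_cases h : γ = α
      · subst h
        exact ⟨P, by simp⟩
      · exact ⟨0, by simp [h]⟩
  · obtain ⟨huM, huV⟩ := Finset.mem_sdiff.1 hu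
    obtain ⟨q, ⟨h0, h1, h2⟩, rfl⟩ := hMA u huM
    obtain ⟨i, hi, hqi⟩ : ∃ i ∈ Δ, 0 < q i := by
      by_contra! h
      have := Finset.sum_nonpos h
      rw [h1] at this
      linarith
    obtain ⟨j, hj, hij, hqj⟩ : ∃ j ∈ Δ, j ≠ i ∧ 0 < q j := by
      by_contra! h
      have hz : ∀ j ∈ Δ, j ≠ i → q j = 0 := fun j hj hne => le_antisymm (h j hj hne) (h0 j hj)
      have hqi1 : q i = 1 := by
        rw [← h1, Finset.sum_eq_single i hz (fun h => absurd hi h)]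
      refine huV (Finset.mem_image.2 ⟨i, hi, ?_⟩)
      rw [ratPoint, Finset.sum_eq_single i (fun γ hγ hne => by simp [hz γ hγ hne])
        (fun h => absurd hi h), hqi1, one_smul]
    have hge : ∀ k ∈ Δ, 0 < q k → 1 / (P : ℚ) ≤ q k := by
      intro k hk hqk
      obtain ⟨z, hz⟩ := h2 k hk
      rw [div_le_iff₀ hP0, hz]
      have : (0 : ℚ) < z := by
        rw [← hz]
        positivity
      have : (0 : ℤ) < z := by exact_mod_cast this
      exact_mod_cast this
    have key : ∀ i ∈ Δ, ∀ j ∈ Δ, j ≠ i → 0 < q j →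
        ratPoint Δ q + (1 / (P : ℚ)) • (toRat i - toRat j) ∈ M := by
      intro i hi j hj hij hqj
      have h3 : ratPoint Δ q + (1 / (P : ℚ)) • (toRat i - toRat j) =
          ratPoint Δ (q + (1 / (P : ℚ)) • (Pi.single i 1 - Pi.single j 1)) := by
        simp only [ratPoint, Pi.add_apply, Pi.smul_apply, Pi.sub_apply, add_smul,
          Finset.sum_add_distrib, smul_eq_mul, mul_smul, ← Finset.smul_sum, sub_smul,
          Finset.sum_sub_distrib]
        congr 3
        · rw [Finset.sum_eq_single i (fun γ _ hne => by simp [hne]) (fun h => absurd hi h)]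
          simp
        · rw [Finset.sum_eq_single j (fun γ _ hne => by simp [hne]) (fun h => absurd hj h)]
          simp
      rw [h3]
      refine hAM _ ⟨fun γ hγ => ?_, ?_, fun γ hγ => ?_⟩
      · simp only [Pi.add_apply, Pi.smul_apply, Pi.sub_apply, smul_eq_mul]
        have h4 : 0 ≤ 1 / (P : ℚ) := by positivity
        by_cases hγj : γ = j
        · subst hγj
          have := hge γ hγ hqj
          simp only [Pi.single_eq_same, Pi.single_eq_of_ne hij]
          linarith
        · have h5 : (0 : ℚ) ≤ Pi.single (M := fun _ => ℚ) i 1 γ := by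
            by_cases hγi : γ = i
            · subst hγi; simp
            · simp [hγi]
          rw [Pi.single_eq_of_ne hγj, sub_zero]
          exact add_nonneg (h0 γ hγ) (mul_nonneg h4 h5)
      · have h6 : ∀ i ∈ Δ, ∑ γ ∈ Δ, Pi.single (M := fun _ => ℚ) i 1 γ = 1 := fun i hi => by
          simp [hi]
        simp only [Pi.add_apply, Pi.smul_apply, Pi.sub_apply, smul_eq_mul,
          Finset.sum_add_distrib, ← Finset.mul_sum, Finset.sum_sub_distrib, h1, h6 i hi, h6 j hj]
        ring
      · obtain ⟨z, hz⟩ := h2 γ hγ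
        have h5 : ∀ i, ∃ y : ℤ, (Pi.single (M := fun _ => ℚ) i 1 γ) = y := by
          intro i
          by_cases hγi : γ = i
          · subst hγi; exact ⟨1, by simp⟩
          · exact ⟨0, by simp [hγi]⟩
        obtain ⟨y, hy⟩ := h5 i
        obtain ⟨x, hx⟩ := h5 j
        refine ⟨z + (y - x), ?_⟩
        simp only [Pi.add_apply, Pi.smul_apply, Pi.sub_apply, smul_eq_mul, add_mul, hz, hy, hx]
        push_cast
        field_simp
    refine ⟨_, _, key i hi j hj hij hqj, key j hj i hi hij.symm hqi, fun he => ?_, ?_⟩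
    · have h3 : (2 / (P : ℚ)) • (toRat i - toRat j) = 0 := by
        have := sub_eq_zero.2 he
        rw [← this]
        module
      rcases smul_eq_zero.1 h3 with h4 | h4
      · exact (div_pos two_pos hP0).ne' h4
      · exact hij (toRat_injective (sub_eq_zero.1 h4)).symm
    · module
  · obtain ⟨q, ⟨-, -, h2⟩, rfl⟩ := hMA u hu
    refine ratPoint_mem_evenPoints hΔ fun α hα => ?_
    obtain ⟨z, hz⟩ := h2 α hα
    rw [eq_div_of_mul_eq hP0.ne' hz]
    exact int_div_mem_oddDen z hP

/-- A point with nonnegative weights is the midpoint of one whose weights have odd denominators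
and one with smaller dyadic denominators. -/
lemma exists_odd_weights {ι : Type*} [DecidableEq ι] {Δ : Finset ι} {q : ι → ℚ}
    (hq0 : ∀ α ∈ Δ, 0 ≤ q α) (hq1 : ∑ α ∈ Δ, q α = 1) :
    ∃ (p : ℕ) (r : ι → ℚ), Odd p ∧ (∀ α ∈ Δ, 0 ≤ r α) ∧ (∀ α ∈ Δ, r α ≤ 2 * q α) ∧
      ∑ α ∈ Δ, r α = 1 ∧ ∀ α ∈ Δ, ∃ z : ℤ, r α * p = z := by
  have hne : Δ.Nonempty := by
    rw [Finset.nonempty_iff_ne_empty]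
    rintro rfl
    simp at hq1
  obtain ⟨i, hi, hmax⟩ := Δ.exists_max_image q hne
  set m : ℕ := Δ.card with hm
  have hm0 : (0 : ℚ) < m := by exact_mod_cast hne.card_pos
  have hqi : 1 ≤ m * q i := by
    rw [← hq1, hm, ← nsmul_eq_mul]
    exact Finset.sum_le_card_nsmul _ _ _ hmax
  -- An odd number large enough that the total rounding loss, at most `m / p`, does not exceed the
  -- largest weight, which is at least `1 / m`.
  set p : ℕ := 2 * (m * m) + 1 with hp
  have hp0 : (0 : ℚ) < p := by positivity
  set r₀ : ι → ℚ := fun α => (⌊q α * p⌋ : ℚ) / p with hr₀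
  have hr0 : ∀ α ∈ Δ, 0 ≤ r₀ α := by
    intro α hα
    have : (0 : ℤ) ≤ ⌊q α * p⌋ := Int.floor_nonneg.2 (mul_nonneg (hq0 α hα) hp0.le)
    have : (0 : ℚ) ≤ ⌊q α * p⌋ := by exact_mod_cast this
    exact div_nonneg this hp0.le
  have hrq : ∀ α, r₀ α ≤ q α := fun α => (div_le_iff₀ hp0).2 (Int.floor_le _)
  have hqr : ∀ α, q α ≤ r₀ α + 1 / p := by
    intro α
    rw [hr₀, ← add_div, le_div_iff₀ hp0]
    exact (Int.lt_floor_add_one _).le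
  have hsum := Finset.add_sum_erase Δ q hi
  have hlow : ∑ α ∈ Δ.erase i, r₀ α ≤ ∑ α ∈ Δ.erase i, q α :=
    Finset.sum_le_sum fun α _ => hrq α
  have hup : ∑ α ∈ Δ.erase i, q α ≤ ∑ α ∈ Δ.erase i, r₀ α + m / p := by
    have h1 : ∑ α ∈ Δ.erase i, q α ≤ ∑ α ∈ Δ.erase i, (r₀ α + 1 / p) :=
      Finset.sum_le_sum fun α _ => hqr α
    rw [Finset.sum_add_distrib, Finset.sum_const, nsmul_eq_mul, mul_one_div] at h1
    refine h1.trans (add_le_add_right ?_ _)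
    gcongr
    exact_mod_cast Finset.card_le_card (Finset.erase_subset i Δ)
  have hmp : (m : ℚ) / p ≤ q i := by
    rw [div_le_iff₀ hp0]
    have h2 : (p : ℚ) = 2 * (m * m) + 1 := by push_cast [hp]; ring
    have h3 : (0 : ℚ) ≤ q i := hq0 i hi
    rw [h2]
    nlinarith [mul_le_mul_of_nonneg_left hqi hm0.le]
  -- Round all weights down to multiples of `1/p` and let the largest one absorb the loss; it at
  -- most doubles.
  set r : ι → ℚ := fun α => if α = i then 1 - ∑ α ∈ Δ.erase i, r₀ α else r₀ α with hr
  have hri : r i = 1 - ∑ α ∈ Δ.erase i, r₀ α := by simp [hr]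
  have hrne : ∀ α, α ≠ i → r α = r₀ α := fun α h => by simp [hr, h]
  refine ⟨p, r, ⟨m * m, rfl⟩, fun α hα => ?_, fun α hα => ?_, ?_, fun α hα => ?_⟩
  · by_cases h : α = i
    · rw [h, hri]
      linarith [hq0 i hi]
    · rw [hrne α h]
      exact hr0 α hα
  · by_cases h : α = i
    · rw [h, hri]
      linarith
    · rw [hrne α h]
      linarith [hrq α, hq0 α hα]
  · rw [← Finset.add_sum_erase Δ r hi, hri,
      Finset.sum_congr rfl fun α hα => hrne α (Finset.ne_of_mem_erase hα)]
    ring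
  · by_cases h : α = i
    · refine ⟨p - ∑ α ∈ Δ.erase i, ⌊q α * p⌋, ?_⟩
      rw [h, hri, sub_mul, hr₀, ← Finset.sum_div, div_mul_cancel₀ _ hp0.ne']
      push_cast
      ring
    · exact ⟨⌊q α * p⌋, by rw [hrne α h, hr₀, div_mul_cancel₀ _ hp0.ne']⟩

/-- The point is the midpoint of one with odd-denominator weights `r` and one with weights `2q - r`,
which have one factor of two fewer in the denominator. The latter point is even because its half is
the given point, with odd denominators, minus half of an even point. So the exceptional point is
only ever the given one. -/
lemma exists_mediated_of_two_pow {Δ : Finset (Fin n →₀ ℕ)} (hΔ : ∀ α ∈ Δ, IsEven α) (s : ℕ) :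
    ∀ (P : ℕ) (q : (Fin n →₀ ℕ) → ℚ), Odd P → (∀ α ∈ Δ, 0 ≤ q α) → ∑ α ∈ Δ, q α = 1 →
      (∀ α ∈ Δ, ∃ z : ℤ, q α * (2 ^ s * P) = z) → (∀ i, ratPoint Δ q i ∈ oddDen) →
      ∃ M : Finset (Fin n → ℚ), IsRationalMediated Δ M ∧ ratPoint Δ q ∈ M ∧
        ∀ u ∈ M, u ≠ ratPoint Δ q → u ∈ evenPoints n := by
  classical
  induction s with
  | zero =>
    intro P q hP hq0 hq1 hqP _
    obtain ⟨M, h1, h2, h3⟩ := exists_mediated_of_odd hΔ hP hq0 hq1 (by simpa using hqP)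
    exact ⟨M, h1, h2, fun u hu _ => h3 hu⟩
  | succ s ih =>
    intro P q hP hq0 hq1 hqP hu
    obtain ⟨p, r, hp, hr0, hrq, hr1, hrp⟩ := exists_odd_weights hq0 hq1
    obtain ⟨M₁, hM₁, hrM, hM₁e⟩ := exists_mediated_of_odd hΔ hp hr0 hr1 hrp
    -- In the case of equality the two endpoints would coincide, but then the point already lies in
    -- the grid `M₁`.
    by_cases heq : ratPoint Δ r = ratPoint Δ q
    · exact ⟨M₁, hM₁, heq ▸ hrM, fun u hu _ => hM₁e hu⟩
    have hw : ratPoint Δ (fun α => 2 * q α - r α) = (2 : ℚ) • ratPoint Δ q - ratPoint Δ r := by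
      simp only [ratPoint, sub_smul, mul_smul, Finset.sum_sub_distrib, ← Finset.smul_sum]
    have hwe : ratPoint Δ (fun α => 2 * q α - r α) ∈ evenPoints n := by
      intro i
      have h1 := oddDen.sub_mem (hu i) (hM₁e hrM i)
      rw [hw]
      simp only [Pi.sub_apply, Pi.smul_apply, smul_eq_mul]
      convert h1 using 1
      ring
    obtain ⟨M₂, hM₂, hwM, hM₂e⟩ := ih (P * p) (fun α => 2 * q α - r α) (hP.mul hp)
      (fun α hα => by linarith [hrq α hα])
      (by rw [Finset.sum_sub_distrib, ← Finset.mul_sum, hq1, hr1]; norm_num)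
      (fun α hα => by
        obtain ⟨z, hz⟩ := hqP α hα
        obtain ⟨y, hy⟩ := hrp α hα
        refine ⟨z * p - 2 ^ s * P * y, ?_⟩
        push_cast
        rw [← hz, ← hy]
        ring)
      (fun i => ((mem_evenPoints.1 hwe).1 i))
    refine ⟨insert (ratPoint Δ q) (M₁ ∪ M₂), ⟨?_, fun u hu' => ?_⟩, Finset.mem_insert_self _ _,
      fun u hu' hne => ?_⟩
    · exact hM₁.1.trans (Finset.subset_union_left.trans (Finset.subset_insert _ _))
    · have hmono : ∀ M' ⊆ insert (ratPoint Δ q) (M₁ ∪ M₂), (∃ v w, IsAverage M' u v w) →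
          ∃ v w, IsAverage (insert (ratPoint Δ q) (M₁ ∪ M₂)) u v w :=
        fun M' hM' ⟨v, w, h1, h2, h3⟩ => ⟨v, w, hM' h1, hM' h2, h3⟩
      obtain ⟨h1, h2⟩ := Finset.mem_sdiff.1 hu'
      rcases Finset.mem_insert.1 h1 with rfl | h3
      · refine ⟨ratPoint Δ r, ratPoint Δ (fun α => 2 * q α - r α), ?_, ?_, fun he => heq ?_, ?_⟩
        · exact Finset.mem_insert_of_mem (Finset.mem_union_left _ hrM)
        · exact Finset.mem_insert_of_mem (Finset.mem_union_right _ hwM)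
        · rw [hw] at he
          have h3 : (2 : ℚ) • ratPoint Δ r = (2 : ℚ) • ratPoint Δ q := by
            nth_rewrite 1 [two_smul, he]
            module
          exact (smul_right_injective _ two_ne_zero) h3
        · rw [hw]
          module
      · rcases Finset.mem_union.1 h3 with h4 | h4
        · exact hmono M₁ (Finset.subset_union_left.trans (Finset.subset_insert _ _))
            (hM₁.2 u (Finset.mem_sdiff.2 ⟨h4, h2⟩))
        · exact hmono M₂ (Finset.subset_union_right.trans (Finset.subset_insert _ _))
            (hM₂.2 u (Finset.mem_sdiff.2 ⟨h4, h2⟩))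
    · rcases Finset.mem_insert.1 hu' with h1 | h1
      · exact absurd h1 hne
      · rcases Finset.mem_union.1 h1 with h2 | h2
        · exact hM₁e h2
        · by_cases h3 : u = ratPoint Δ fun α => 2 * q α - r α
          · rw [h3]
            exact hwe
          · exact hM₂e u h2 h3

/-- The barycentric coordinates of a lattice point in a lattice simplex are rational. -/
lemma exists_rat_bary {Δ : Finset (Fin n →₀ ℕ)} {β : Fin n →₀ ℕ} (hΔ : IsSimplexVertices Δ)
    (h : InSimplexInterior Δ β) : ∃ q : (Fin n →₀ ℕ) → ℚ, (∀ α ∈ Δ, 0 ≤ q α) ∧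
      ∑ α ∈ Δ, q α = 1 ∧ ratPoint Δ q = toRat β := by
  -- A `ℚ`-linear retraction of `ℝ` onto `ℚ` carries the barycentric equations to rational ones;
  -- uniqueness of barycentric coordinates then shows that nothing has changed.
  obtain ⟨φ, hφ⟩ := LinearMap.exists_leftInverse_of_injective (Algebra.linearMap ℚ ℝ)
    (LinearMap.ker_eq_bot.2 (algebraMap ℚ ℝ).injective)
  have hφq : ∀ x : ℚ, φ (x : ℝ) = x := fun x => LinearMap.congr_fun hφ x
  set q : (Fin n →₀ ℕ) → ℚ := fun α => φ (bary Δ β α) with hq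
  have h1 : ∑ α ∈ Δ, q α = 1 := by
    rw [hq, ← map_sum, sum_bary h]
    exact_mod_cast hφq 1
  have h2 : ratPoint Δ q = toRat β := by
    funext i
    have e1 := congrArg φ (congrFun (sum_bary_smul h) i)
    simp only [Finset.sum_apply, Pi.smul_apply, smul_eq_mul, map_sum, toReal] at e1
    have e2 : φ ((β i : ℕ) : ℝ) = β i := by exact_mod_cast hφq (β i)
    rw [e2] at e1
    rw [ratPoint, Finset.sum_apply]
    simp only [toRat, Pi.smul_apply, smul_eq_mul]
    rw [← e1]
    refine Finset.sum_congr rfl fun α _ => ?_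
    have e3 : bary Δ β α * (α i : ℝ) = (α i : ℚ) • bary Δ β α := by
      rw [Rat.smul_def, mul_comm]
      simp
    rw [e3, map_smul, smul_eq_mul, mul_comm]
  have h3 : ∀ α ∈ Δ, (q α : ℝ) = bary Δ β α := by
    intro α hα
    refine eq_bary hΔ h (k := fun α => (q α : ℝ)) ?_ ?_ hα
    · exact_mod_cast h1
    · funext i
      have e1 := congrFun h2 i
      rw [ratPoint, Finset.sum_apply] at e1
      simp only [toRat, Pi.smul_apply, smul_eq_mul] at e1
      rw [Finset.sum_apply]
      simp only [toReal, Pi.smul_apply, smul_eq_mul]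
      exact_mod_cast congrArg (fun x : ℚ => (x : ℝ)) e1
  refine ⟨q, fun α hα => ?_, h1, h2⟩
  have : (0 : ℝ) ≤ q α := by
    rw [h3 α hα]
    exact bary_nonneg _ _ _
  exact_mod_cast this

/-- Even simplices have odd mediated sets through each of their interior lattice points. -/
theorem exists_isOddMediated {Δ : Finset (Fin n →₀ ℕ)} {β : Fin n →₀ ℕ}
    (hev : ∀ α ∈ Δ, IsEven α) (hΔ : IsSimplexVertices Δ) (h : InSimplexInterior Δ β) :
    ∃ M : Finset (Fin n → ℚ), IsOddMediated Δ β M := by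
  obtain ⟨q, hq0, hq1, hqβ⟩ := exists_rat_bary hΔ h
  have hD : ∏ α ∈ Δ, (q α).den ≠ 0 := Finset.prod_ne_zero_iff.2 fun α _ => (q α).den_nz
  obtain ⟨s, P, hP, hsP⟩ := Nat.exists_eq_two_pow_mul_odd hD
  have hβ : ∀ i, toRat β i ∈ oddDen := fun i => natCast_mem oddDen (β i)
  obtain ⟨M, h1, h2, h3⟩ := exists_mediated_of_two_pow hev s P q hP hq0 hq1
    (fun α hα => by
      obtain ⟨k, hk⟩ := Finset.dvd_prod_of_mem (fun α => (q α).den) hα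
      refine ⟨(q α).num * k, ?_⟩
      have h4 : (2 : ℚ) ^ s * P = (q α).den * k := by
        rw [hsP] at hk
        exact_mod_cast hk
      rw [h4, ← mul_assoc, Rat.mul_den_eq_num]
      push_cast
      rfl)
    (by rwa [hqβ])
  rw [hqβ] at h2 h3
  refine ⟨M, h1, h2, fun u hu i => ?_, fun u hu hne => (mem_evenPoints.1 (h3 u hu hne)).2⟩
  by_cases hne : u = toRat β
  · rw [hne]
    exact hβ i
  · exact (mem_evenPoints.1 (h3 u hu hne)).1 i

end Sonc

/-! ### Discrete potential theory on mediated sets. -/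

namespace Sonc

variable {n : ℕ}

section Mediated

variable {M V : Finset (Fin n → ℚ)} {v w : (Fin n → ℚ) → (Fin n → ℚ)}
  (hvw : ∀ u ∈ M \ V, IsAverage M u (v u) (w u))
include hvw

/-- The minimum principle on a mediated set. -/
lemma nonneg_of_superharmonic {g : (Fin n → ℚ) → ℝ}
    (hg : ∀ u ∈ M \ V, g (v u) + g (w u) ≤ 2 * g u) (hV : ∀ u ∈ V, 0 ≤ g u) :
    ∀ u ∈ M, 0 ≤ g u := by
  by_contra! hneg
  obtain ⟨x, hx, hgx⟩ := hneg
  obtain ⟨y, hy, hmin⟩ := M.exists_min_image g ⟨x, hx⟩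
  have hgy : g y < 0 := (hmin x hx).trans_lt hgx
  -- Take a minimizer of greatest Euclidean norm. Both neighbours are minimizers too, hence no
  -- longer than their midpoint `u`; the parallelogram law contradicts `v u ≠ w u`.
  obtain ⟨u, hu, hmax⟩ := (M.filter fun u => g u = g y).exists_max_image (fun u => u ⬝ᵥ u)
    ⟨y, Finset.mem_filter.2 ⟨hy, rfl⟩⟩
  obtain ⟨huM, hgu⟩ := Finset.mem_filter.1 hu
  have huV : u ∉ V := fun h => by linarith [hV u h]
  have huU := Finset.mem_sdiff.2 ⟨huM, huV⟩
  obtain ⟨h1, h2, h3, h4⟩ := hvw u huU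
  have h5 := hg u huU
  have h6 := hmin _ h1
  have h7 := hmin _ h2
  have h8 := hmax _ (Finset.mem_filter.2 ⟨h1, by linarith⟩)
  have h9 := hmax _ (Finset.mem_filter.2 ⟨h2, by linarith⟩)
  have h10 : 0 < (v u - w u) ⬝ᵥ (v u - w u) := by
    refine lt_of_le_of_ne (Finset.sum_nonneg fun i _ => mul_self_nonneg _) fun h => h3 ?_
    exact sub_eq_zero.1 (dotProduct_self_eq_zero.1 h.symm)
  have h11 : u ⬝ᵥ u = (1 / 2 : ℚ) • (v u + w u) ⬝ᵥ (1 / 2 : ℚ) • (v u + w u) := by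
    rw [← h4]
  rw [h11] at h8 h9
  simp only [sub_dotProduct, dotProduct_sub, add_dotProduct, dotProduct_add, smul_dotProduct,
    dotProduct_smul, smul_eq_mul, dotProduct_comm (w u) (v u)] at h8 h9 h10
  linarith

open Classical in
/-- The discrete Laplacian of a mediated set with zero boundary values is invertible. -/
lemma exists_laplacian_equiv :
    ∃ (ext : (Fin n → ℚ) → (({u // u ∈ M \ V} → ℝ) →ₗ[ℝ] ℝ))
      (T : ({u // u ∈ M \ V} → ℝ) ≃ₗ[ℝ] ({u // u ∈ M \ V} → ℝ)),
      (∀ g u, ext u g = if h : u ∈ M \ V then g ⟨u, h⟩ else 0) ∧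
      (∀ g u, T g u = 2 * g u - ext (v u) g - ext (w u) g) := by
  set ext : (Fin n → ℚ) → (({u // u ∈ M \ V} → ℝ) →ₗ[ℝ] ℝ) := fun x =>
    if h : x ∈ M \ V then LinearMap.proj ⟨x, h⟩ else 0 with hext
  have hext' : ∀ g u, ext u g = if h : u ∈ M \ V then g ⟨u, h⟩ else 0 := by
    intro g u
    simp only [hext]
    split_ifs <;> simp
  have hU : ∀ g (u : {u // u ∈ M \ V}), ext u g = g u := by
    intro g u
    rw [hext', dif_pos u.2]
  have hV : ∀ g, ∀ u ∈ V, ext u g = 0 := by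
    intro g u hu
    rw [hext', dif_neg fun h => (Finset.mem_sdiff.1 h).2 hu]
  set T : ({u // u ∈ M \ V} → ℝ) →ₗ[ℝ] ({u // u ∈ M \ V} → ℝ) :=
    LinearMap.pi fun u => (2 : ℝ) • LinearMap.proj u - ext (v u) - ext (w u) with hT
  have hT' : ∀ g u, T g u = 2 * g u - ext (v u) g - ext (w u) g := fun g u => by simp [hT]
  have hinj : Function.Injective T := by
    rw [← LinearMap.ker_eq_bot, LinearMap.ker_eq_bot']
    intro g hg
    have h0 : ∀ u (hu : u ∈ M \ V), 2 * ext u g = ext (v u) g + ext (w u) g := by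
      intro u hu
      have := congrFun hg ⟨u, hu⟩
      rw [hT', Pi.zero_apply] at this
      have h1 := hU g ⟨u, hu⟩
      simp only at h1 this
      linarith
    have h1 := nonneg_of_superharmonic hvw (g := fun u => ext u g)
      (fun u hu => (h0 u hu).ge) (fun u hu => (hV g u hu).ge)
    have h2 := nonneg_of_superharmonic hvw (g := fun u => - ext u g)
      (fun u hu => by linarith [h0 u hu]) (fun u hu => by rw [hV g u hu, neg_zero])
    funext u
    have h3 := h1 u (Finset.mem_sdiff.1 u.2).1
    have h4 := h2 u (Finset.mem_sdiff.1 u.2).1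
    rw [hU] at h3 h4
    exact le_antisymm (neg_nonneg.1 h4) h3
  exact ⟨ext, LinearEquiv.ofBijective T ⟨hinj, LinearMap.injective_iff_surjective.1 hinj⟩,
    hext', fun g u => hT' g u⟩

/-- Functions on the vertices extend harmonically to a mediated set. -/
lemma exists_harmonic_extension (s : (Fin n → ℚ) → ℝ) :
    ∃ l : (Fin n → ℚ) → ℝ, (∀ u ∈ V, l u = s u) ∧ ∀ u ∈ M \ V, 2 * l u = l (v u) + l (w u) := by
  classical
  obtain ⟨ext, T, hext, hT⟩ := exists_laplacian_equiv hvw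
  set s' : (Fin n → ℚ) → ℝ := fun x => if x ∈ V then s x else 0 with hs'
  set g := T.symm fun u => s' (v u) + s' (w u) with hg
  refine ⟨fun x => ext x g + s' x, fun u hu => ?_, fun u hu => ?_⟩
  · have h1 : ext u g = 0 := by rw [hext, dif_neg fun h => (Finset.mem_sdiff.1 h).2 hu]
    simp [hs', hu, h1]
  · have h1 : T g ⟨u, hu⟩ = s' (v u) + s' (w u) := by rw [hg, LinearEquiv.apply_symm_apply]
    rw [hT] at h1
    have h2 : ext u g = g ⟨u, hu⟩ := by rw [hext, dif_pos hu]
    have h3 : s' u = 0 := by simp [hs', (Finset.mem_sdiff.1 hu).2]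
    simp only at h1 ⊢
    rw [h2, h3]
    linarith

/-- The Green function of a mediated set with pole `b`. -/
lemma exists_green_function {b : Fin n → ℚ} (hb : b ∈ M \ V) :
    ∃ G : (Fin n → ℚ) → ℝ, (∀ u ∈ M \ V, 0 ≤ G u) ∧ 1 / 2 ≤ G b ∧
      ∀ g : (Fin n → ℚ) → ℝ, (∀ u ∈ V, g u = 0) →
        ∑ u ∈ M \ V, G u * (2 * g u - g (v u) - g (w u)) = g b := by
  classical
  obtain ⟨ext, T, hext, hT⟩ := exists_laplacian_equiv hvw
  -- The row at `b` of the inverse Laplacian, extended by zero.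
  set G : (Fin n → ℚ) → ℝ := fun x =>
    if h : x ∈ M \ V then T.symm (Pi.single ⟨x, h⟩ 1) ⟨b, hb⟩ else 0 with hG
  have hGs : ∀ u : {u // u ∈ M \ V}, G u = T.symm (Pi.single u 1) ⟨b, hb⟩ := by
    intro u
    rw [hG]
    exact dif_pos u.2
  have hG0 : ∀ u ∈ M \ V, 0 ≤ G u := by
    intro u hu
    set g := T.symm (Pi.single ⟨u, hu⟩ 1) with hg
    have h1 : ∀ x (hx : x ∈ M \ V), 0 ≤ T g ⟨x, hx⟩ := by
      intro x hx
      rw [hg, LinearEquiv.apply_symm_apply]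
      exact (Pi.single_nonneg.2 zero_le_one : (0 : {u // u ∈ M \ V} → ℝ) ≤ _) _
    have h2 := nonneg_of_superharmonic hvw (g := fun x => ext x g)
      (fun x hx => by
        have := h1 x hx
        rw [hT] at this
        rw [hext g x, dif_pos hx]
        simp only at this
        linarith)
      (fun x hx => by rw [hext, dif_neg fun h => (Finset.mem_sdiff.1 h).2 hx]) b
      (Finset.mem_sdiff.1 hb).1
    rw [hext, dif_pos hb] at h2
    rw [hGs ⟨u, hu⟩]
    exact h2
  have hGg : ∀ g : (Fin n → ℚ) → ℝ, (∀ u ∈ V, g u = 0) →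
      ∑ u ∈ M \ V, G u * (2 * g u - g (v u) - g (w u)) = g b := by
    intro g hg
    have hg' : ∀ x ∈ M, ext x (fun u => g u) = g x := by
      intro x hx
      rw [hext]
      split_ifs with h
      · rfl
      · have : x ∈ V := by
          by_contra h1
          exact h (Finset.mem_sdiff.2 ⟨hx, h1⟩)
        rw [hg x this]
    have h1 : T.symm (T fun u => g u) ⟨b, hb⟩ = g b := by rw [LinearEquiv.symm_apply_apply]
    rw [← h1]
    have h2 := LinearMap.pi_apply_eq_sum_univ
      ((LinearMap.proj (⟨b, hb⟩ : {u // u ∈ M \ V})).comp T.symm.toLinearMap) (T fun u => g u)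
    simp only [LinearMap.comp_apply, LinearMap.proj_apply, LinearEquiv.coe_coe] at h2
    rw [h2, ← Finset.sum_coe_sort (M \ V)]
    refine Finset.sum_congr rfl fun u _ => ?_
    obtain ⟨h3, h4, -⟩ := hvw u u.2
    rw [hT, hg' _ h3, hg' _ h4, hGs, smul_eq_mul, mul_comm]
    have h5 : (Pi.single u 1 : {u // u ∈ M \ V} → ℝ) = fun j => if u = j then 1 else 0 := by
      funext x
      simp [Pi.single_apply, eq_comm]
    rw [h5]
  refine ⟨G, hG0, ?_, hGg⟩
  -- Testing with the indicator of `b` gives `1 ≤ 2 G b`, since the neighbour terms only subtract.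
  have h1 := hGg (fun x => if x = b then 1 else 0) fun u hu => by
    rw [if_neg]
    rintro rfl
    exact (Finset.mem_sdiff.1 hb).2 hu
  simp only [if_true] at h1
  have h2 : ∑ u ∈ M \ V, G u * (2 * (if u = b then 1 else 0) - (if v u = b then 1 else 0) -
      (if w u = b then 1 else 0)) ≤ ∑ u ∈ M \ V, if u = b then 2 * G u else 0 := by
    refine Finset.sum_le_sum fun u hu => ?_
    have := hG0 u hu
    split_ifs <;> linarith
  rw [Finset.sum_ite_eq' _ _ _, if_pos hb] at h2
  linarith

/-- The representation of the point evaluation at `b` by vertices and midpoint defects. -/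
lemma exists_mean_value_identity (hVM : V ⊆ M) {b : Fin n → ℚ} (hb : b ∈ M \ V) :
    ∃ G k : (Fin n → ℚ) → ℝ, (∀ u ∈ M \ V, 0 ≤ G u) ∧ 1 / 2 ≤ G b ∧
      ∀ {X : Type} [AddCommGroup X] [Module ℝ X] (φ : (Fin n → ℚ) → X),
        ∑ u ∈ M \ V, G u • (φ (v u) + φ (w u) - (2 : ℝ) • φ u) =
          ∑ α ∈ V, k α • φ α - φ b := by
  classical
  obtain ⟨G, hG0, hGb, hG⟩ := exists_green_function hvw hb
  set δ : (Fin n → ℚ) → (Fin n → ℚ) → ℝ := fun m x => if x = m then 1 else 0 with hδ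
  refine ⟨G, fun m => ∑ u ∈ M \ V, G u * (δ m (v u) + δ m (w u) - 2 * δ m u), hG0, hGb, ?_⟩
  intro X _ _ φ
  have hφ : ∀ x ∈ M, φ x = ∑ m ∈ M, δ m x • φ m := by
    intro x hx
    rw [Finset.sum_eq_single x (fun m _ hne => by simp [hδ, hne.symm]) (fun h => absurd hx h)]
    simp [hδ]
  have h1 : ∑ u ∈ M \ V, G u • (φ (v u) + φ (w u) - (2 : ℝ) • φ u) =
      ∑ m ∈ M, (∑ u ∈ M \ V, G u * (δ m (v u) + δ m (w u) - 2 * δ m u)) • φ m := by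
    simp only [Finset.sum_smul]
    rw [Finset.sum_comm]
    refine Finset.sum_congr rfl fun u hu => ?_
    obtain ⟨h2, h3, -⟩ := hvw u hu
    rw [hφ _ h2, hφ _ h3, hφ u (Finset.mem_sdiff.1 hu).1, Finset.smul_sum,
      ← Finset.sum_add_distrib, ← Finset.sum_sub_distrib, Finset.smul_sum]
    refine Finset.sum_congr rfl fun m _ => ?_
    module
  have h2 : ∀ m ∈ M \ V, ∑ u ∈ M \ V, G u * (δ m (v u) + δ m (w u) - 2 * δ m u) = - δ m b := by
    intro m hm
    rw [← hG (δ m) fun u hu => ?_, ← Finset.sum_neg_distrib]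
    · exact Finset.sum_congr rfl fun u _ => by ring
    · simp only [hδ]
      rw [if_neg]
      rintro rfl
      exact (Finset.mem_sdiff.1 hm).2 hu
  rw [h1, ← Finset.sum_sdiff hVM, Finset.sum_congr rfl fun m hm => by rw [h2 m hm],
    Finset.sum_eq_single b (fun m _ hne => by simp [hδ, hne.symm]) (fun h => absurd hb h)]
  simp only [hδ, if_true]
  rw [neg_one_smul]
  abel

end Mediated

/-- The mean value identity on a mediated set of a simplex, with barycentric coordinates. -/
lemma exists_bary_identity {Δ : Finset (Fin n →₀ ℕ)} {β : Fin n →₀ ℕ} {M : Finset (Fin n → ℚ)}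
    {v w : (Fin n → ℚ) → (Fin n → ℚ)} (hΔ : IsSimplexVertices Δ) (h : InSimplexInterior Δ β)
    (hβ : β ∉ Δ) (hM : ratVertices Δ ⊆ M) (hβM : toRat β ∈ M)
    (hvw : ∀ u ∈ M \ ratVertices Δ, IsAverage M u (v u) (w u)) :
    ∃ G : (Fin n → ℚ) → ℝ, (∀ u ∈ M \ ratVertices Δ, 0 ≤ G u) ∧ 1 / 2 ≤ G (toRat β) ∧
      ∀ {X : Type} [AddCommGroup X] [Module ℝ X] (φ : (Fin n → ℚ) → X),
        ∑ u ∈ M \ ratVertices Δ, G u • (φ (v u) + φ (w u) - (2 : ℝ) • φ u) =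
          ∑ α ∈ Δ, bary Δ β α • φ (toRat α) - φ (toRat β) := by
  classical
  have hβV : toRat β ∈ M \ ratVertices Δ := by
    refine Finset.mem_sdiff.2 ⟨hβM, fun h1 => hβ ?_⟩
    obtain ⟨α, hα, he⟩ := Finset.mem_image.1 h1
    rwa [← toRat_injective he]
  obtain ⟨G, k, hG0, hGb, hG⟩ := exists_mean_value_identity hvw hM hβV
  have himg : ∀ {X : Type} [AddCommGroup X] [Module ℝ X] (φ : (Fin n → ℚ) → X),
      ∑ α ∈ ratVertices Δ, k α • φ α = ∑ α ∈ Δ, k (toRat α) • φ (toRat α) := by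
    intro X _ _ φ
    rw [ratVertices]
    convert Finset.sum_image (f := fun α => k α • φ α) toRat_injective.injOn
  -- Midpoint defects vanish for constants and for coordinate functions, so the boundary weights `k`
  -- are affine weights representing `β`, that is, its barycentric coordinates.
  have h1 := hG (fun _ => (1 : ℝ))
  have h2 := hG (fun x i => (x i : ℝ))
  rw [himg, Finset.sum_eq_zero fun u _ => by norm_num] at h1
  rw [himg, Finset.sum_eq_zero fun u hu => by
    rw [smul_eq_zero]
    right
    funext i
    have h3 := congrFun (hvw u hu).2.2.2 i
    simp only [Pi.smul_apply, Pi.add_apply, smul_eq_mul] at h3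
    simp only [Pi.sub_apply, Pi.smul_apply, Pi.add_apply, smul_eq_mul, h3, Pi.zero_apply]
    push_cast
    ring] at h2
  have hk : ∀ α ∈ Δ, k (toRat α) = bary Δ β α := by
    intro α hα
    refine eq_bary hΔ h (k := fun α => k (toRat α)) ?_ ?_ hα
    · simp only [smul_eq_mul, mul_one] at h1
      linarith
    · have h3 := (sub_eq_zero.1 h2.symm)
      have h4 : ∀ α : Fin n →₀ ℕ, (fun i => ((toRat α i : ℚ) : ℝ)) = toReal α := by
        intro α
        funext i
        simp [toRat, toReal]
      simpa only [h4] using h3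
  refine ⟨G, hG0, hGb, fun φ => ?_⟩
  rw [hG, himg]
  congr 1
  exact Finset.sum_congr rfl fun α hα => by rw [hk α hα]

end Sonc

/-! ### Nonnegativity of certified circuits by weighted AM-GM. -/

namespace Sonc

variable {n : ℕ}

open MvPolynomial

lemma eval_monomial_eq_prod (x : Fin n → ℝ) (α : Fin n →₀ ℕ) (c : ℝ) :
    eval x (monomial α c) = c * ∏ i, x i ^ α i := by
  rw [eval_monomial, Finsupp.prod_fintype _ _ fun i => pow_zero _]

/-- The inequality between weighted means, for monomials in the vertices of a simplex. -/
lemma exp_mul_prod_le_sum {Δ : Finset (Fin n →₀ ℕ)} {β : Fin n →₀ ℕ}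
    (h : InSimplexInterior Δ β) (s : (Fin n →₀ ℕ) → ℝ) {x : Fin n → ℝ} (hx : ∀ i, 0 ≤ x i) :
    Real.exp (∑ α ∈ Δ, bary Δ β α * s α) * ∏ i, x i ^ β i ≤
      ∑ α ∈ Δ, bary Δ β α * (Real.exp (s α) * ∏ i, x i ^ α i) := by
  have hp : ∀ α : Fin n →₀ ℕ, 0 ≤ ∏ i, x i ^ α i :=
    fun α => Finset.prod_nonneg fun i _ => pow_nonneg (hx i) _
  refine le_trans (le_of_eq ?_) (Real.geom_mean_le_arith_mean_weighted Δ (bary Δ β)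
    (fun α => Real.exp (s α) * ∏ i, x i ^ α i) (fun α _ => bary_nonneg _ _ _) (sum_bary h)
    fun α _ => mul_nonneg (Real.exp_pos _).le (hp α))
  have h1 : ∀ α ∈ Δ, (Real.exp (s α) * ∏ i, x i ^ α i) ^ bary Δ β α =
      Real.exp (bary Δ β α * s α) * ∏ i, x i ^ ((α i : ℝ) * bary Δ β α) := by
    intro α _
    rw [Real.mul_rpow (Real.exp_pos _).le (hp α), ← Real.exp_mul, mul_comm (s α),
      ← Real.finsetProd_rpow _ _ fun i _ => pow_nonneg (hx i) _]
    congr 1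
    exact Finset.prod_congr rfl fun i _ => (Real.rpow_natCast_mul (hx i) _ _).symm
  rw [Finset.prod_congr rfl h1, Finset.prod_mul_distrib, ← Real.exp_sum, Finset.prod_comm]
  congr 1
  refine Finset.prod_congr rfl fun i _ => ?_
  rw [← Real.rpow_sum_of_nonneg (hx i) fun α _ =>
    mul_nonneg (Nat.cast_nonneg _) (bary_nonneg _ _ _), ← Real.rpow_natCast]
  congr 1
  have := congrFun (sum_bary_smul h) i
  simp only [Finset.sum_apply, Pi.smul_apply, toReal, smul_eq_mul] at this
  rw [← this]
  exact Finset.sum_congr rfl fun α _ => mul_comm _ _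

/-- The certified circuit polynomials are nonnegative. -/
lemma isNonneg_circuit {Δ : Finset (Fin n →₀ ℕ)} {β : Fin n →₀ ℕ} (hev : ∀ α ∈ Δ, IsEven α)
    (h : InSimplexInterior Δ β) {N D : ℝ} (hN : 0 ≤ N) (s : (Fin n →₀ ℕ) → ℝ)
    (hD : |D| ≤ N * Real.exp (∑ α ∈ Δ, bary Δ β α * s α)) :
    IsNonneg (∑ α ∈ Δ, monomial α (N * bary Δ β α * Real.exp (s α)) - monomial β D) := by
  intro x
  rw [map_sub, map_sum, eval_monomial_eq_prod]
  have h1 : ∑ α ∈ Δ, eval x (monomial α (N * bary Δ β α * Real.exp (s α))) =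
      N * ∑ α ∈ Δ, bary Δ β α * (Real.exp (s α) * ∏ i, |x i| ^ α i) := by
    rw [Finset.mul_sum]
    refine Finset.sum_congr rfl fun α hα => ?_
    rw [eval_monomial_eq_prod]
    have : ∏ i, x i ^ α i = ∏ i, |x i| ^ α i :=
      Finset.prod_congr rfl fun i _ => ((hev α hα i).pow_abs _).symm
    rw [this]
    ring
  have h2 := mul_le_mul_of_nonneg_left
    (exp_mul_prod_le_sum h s (x := fun i => |x i|) fun i => abs_nonneg _) hN
  have h3 : D * ∏ i, x i ^ β i ≤ |D| * ∏ i, |x i| ^ β i := by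
    refine (le_abs_self _).trans (le_of_eq ?_)
    rw [abs_mul, Finset.abs_prod]
    simp only [abs_pow]
  have h4 := mul_le_mul_of_nonneg_right hD
    (Finset.prod_nonneg fun i (_ : i ∈ Finset.univ) => pow_nonneg (abs_nonneg (x i)) (β i))
  rw [h1]
  linarith

lemma isSONC_circuit {Δ : Finset (Fin n →₀ ℕ)} {β : Fin n →₀ ℕ} (hev : ∀ α ∈ Δ, IsEven α)
    (hΔ : IsSimplexVertices Δ) (h : InSimplexInterior Δ β) {N D : ℝ} (hN : 0 ≤ N)
    (s : (Fin n →₀ ℕ) → ℝ) (hD : |D| ≤ N * Real.exp (∑ α ∈ Δ, bary Δ β α * s α)) :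
    IsSONC (∑ α ∈ Δ, monomial α (N * bary Δ β α * Real.exp (s α)) - monomial β D) := by
  -- Circuit polynomials need positive vertex coefficients, so `N = 0`, which gives the zero
  -- polynomial, is treated apart.
  rcases hN.eq_or_lt with h0 | h0
  · rw [← h0, zero_mul] at hD
    rw [← h0, abs_nonpos_iff.1 hD]
    have h1 : (∑ α ∈ Δ, monomial α (0 * bary Δ β α * Real.exp (s α)) - monomial β 0 :
        MvPolynomial (Fin n) ℝ) = 0 := by simp
    rw [h1]
    exact (AddSubmonoid.closure _).zero_mem
  · exact AddSubmonoid.subset_closure (Or.inl ⟨⟨Δ, β, _, D, hev, hΔ,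
      fun α hα => by have := bary_pos h hα; positivity, h, rfl⟩, isNonneg_circuit hev h hN s hD⟩)

lemma isSONC_monomial {α : Fin n →₀ ℕ} (hα : IsEven α) {c : ℝ} (hc : 0 ≤ c) :
    IsSONC (monomial α c) := by
  rcases hc.eq_or_lt with h0 | h0
  · rw [← h0, map_zero]
    exact (AddSubmonoid.closure _).zero_mem
  · exact AddSubmonoid.subset_closure (Or.inr ⟨α, c, hα, h0, rfl⟩)

end Sonc

/-! ### SONC polynomials and distributions. -/

namespace Sonc

variable {n : ℕ}

open MvPolynomial

/-- The values of the monomials with natural exponents at positive points. -/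
noncomputable def expEval (y : Fin n → ℝ) (α : Fin n →₀ ℕ) : ℝ := Real.exp (toReal α ⬝ᵥ y)

/-- The values of the monomials with rational exponents at positive points. -/
noncomputable def ratExpEval (y : Fin n → ℝ) (u : Fin n → ℚ) : ℝ :=
  Real.exp ((fun i => (u i : ℝ)) ⬝ᵥ y)

lemma ratExpEval_toRat (y : Fin n → ℝ) (α : Fin n →₀ ℕ) :
    ratExpEval y (toRat α) = expEval y α := by
  simp [ratExpEval, expEval, toRat, toReal, dotProduct]

lemma expEval_eq_prod (y : Fin n → ℝ) (α : Fin n →₀ ℕ) :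
    expEval y α = ∏ i, Real.exp (y i) ^ α i := by
  simp only [expEval, dotProduct, toReal, Real.exp_sum, Real.exp_nat_mul]

lemma eval_eq_sum_of_support_subset {g : MvPolynomial (Fin n) ℝ} {S : Finset (Fin n →₀ ℕ)}
    (hS : ∀ α, α ∉ S → coeff α g = 0) (x : Fin n → ℝ) :
    eval x g = ∑ α ∈ S, coeff α g * ∏ i, x i ^ α i := by
  rw [eval_eq']
  refine Finset.sum_subset (fun α hα => ?_) fun α _ hα => ?_
  · by_contra h
    exact (mem_support_iff.1 hα) (hS α h)
  · rw [notMem_support_iff.1 hα, zero_mul]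

/-- Evaluation at `exp y` gives nonnegativity. Negating a coordinate in which `β` is odd fixes the
even vertex monomials and flips the `β`-term, which is the second AGE inequality. -/
lemma isAGE_of_circuit {g : MvPolynomial (Fin n) ℝ} (hg : IsCircuit g) (hnn : IsNonneg g) :
    ∃ (S : Finset (Fin n →₀ ℕ)) (β : Fin n →₀ ℕ), β ∈ S ∧
      IsAGE expEval {α | IsEven α} S β fun α => coeff α g := by
  classical
  obtain ⟨A, β, c, d, hA, -, hc, -, hgeq⟩ := hg
  have hcoeff : ∀ α, α ≠ β → coeff α g = if α ∈ A then c α else 0 := by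
    intro α hα
    rw [hgeq, coeff_sub, coeff_sum, coeff_monomial, if_neg hα.symm, sub_zero]
    simp [coeff_monomial]
  have hoff : ∀ α, α ∉ insert β A → coeff α g = 0 := by
    intro α hα
    rw [Finset.mem_insert, not_or] at hα
    rw [hcoeff α hα.1, if_neg hα.2]
  refine ⟨insert β A, β, Finset.mem_insert_self _ _, fun α hα => ?_, fun α hα he => ?_, hoff,
    fun y => ⟨?_, fun hβ => ?_⟩⟩
  · simp only
    rw [hcoeff α hα]
    split_ifs with h
    exacts [(hc α h).le, le_rfl]
  · simp only
    rw [hcoeff α hα, if_neg fun h => he (hA α h)]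
  · have := hnn fun i => Real.exp (y i)
    rw [eval_eq_sum_of_support_subset hoff] at this
    simpa only [expEval_eq_prod] using this
  · obtain ⟨i, hi⟩ : ∃ i, Odd (β i) := by
      by_contra! h
      exact hβ fun i => Nat.not_odd_iff_even.1 (h i)
    have h1 := hnn fun j => if j = i then - Real.exp (y j) else Real.exp (y j)
    rw [eval_eq_sum_of_support_subset hoff] at h1
    have h2 : ∀ α : Fin n →₀ ℕ,
        ∏ j, (if j = i then - Real.exp (y j) else Real.exp (y j)) ^ α j =
          (-1) ^ α i * expEval y α := by
      intro α
      have h3 : ∀ j, (if j = i then - Real.exp (y j) else Real.exp (y j)) ^ α j =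
          (if j = i then (-1) ^ α i else 1) * Real.exp (y j) ^ α j := by
        intro j
        split_ifs with h
        · subst h
          rw [neg_pow]
        · rw [one_mul]
      rw [expEval_eq_prod, Finset.prod_congr rfl fun j _ => h3 j, Finset.prod_mul_distrib,
        Finset.prod_ite_eq' Finset.univ i, if_pos (Finset.mem_univ i)]
    have h4 : ∀ α ∈ insert β A, coeff α g * ((-1) ^ α i * expEval y α) =
        coeff α g * expEval y α - if α = β then 2 * coeff β g * expEval y β else 0 := by
      intro α hα
      split_ifs with h
      · subst h
        rw [hi.neg_one_pow]
        ring
      · have hαA : α ∈ A := (Finset.mem_insert.1 hα).resolve_left h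
        rw [(hA α hαA i).neg_one_pow]
        ring
    simp only [h2] at h1
    rw [Finset.sum_congr rfl h4, Finset.sum_sub_distrib, Finset.sum_ite_eq' _ _ _,
      if_pos (Finset.mem_insert_self _ _)] at h1
    linarith

lemma isAGE_single {I Y : Type*} [DecidableEq I] {ev : Y → I → ℝ} (hev : ∀ y α, 0 < ev y α)
    {Ev : Set I} {α : I} (hα : α ∈ Ev) {c : ℝ} (hc : 0 ≤ c) :
    IsAGE ev Ev {α} α fun γ => if γ = α then c else 0 := by
  refine ⟨fun γ hγ => by simp [hγ], fun γ hγ _ => by simp [hγ],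
    fun γ hγ => by simp [Finset.mem_singleton.not.1 hγ], fun y => ⟨?_, fun h => absurd hα h⟩⟩
  simpa using mul_nonneg hc (hev y α).le

lemma IsSONC.mem_ageCone {f : MvPolynomial (Fin n) ℝ} (hf : IsSONC f) :
    (fun α => coeff α f) ∈ ageCone (expEval (n := n)) {α | IsEven α} := by
  classical
  let φ : MvPolynomial (Fin n) ℝ →+ ((Fin n →₀ ℕ) → ℝ) :=
    { toFun := fun f α => coeff α f
      map_zero' := by ext; simp
      map_add' := fun f g => by ext; simp }
  have h : AddSubmonoid.closure {g : MvPolynomial (Fin n) ℝ |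
      (IsCircuit g ∧ IsNonneg g) ∨ IsMonomialSquare g} ≤
      (ageCone (expEval (n := n)) {α | IsEven α}).comap φ := by
    rw [AddSubmonoid.closure_le]
    rintro g (⟨h1, h2⟩ | ⟨α, c, hα, hc, rfl⟩)
    · obtain ⟨S, β, hβ, hg⟩ := isAGE_of_circuit h1 h2
      exact hg.mem_ageCone hβ
    · have h1 := (isAGE_single (ev := expEval (n := n)) (fun y α => Real.exp_pos _)
        (Ev := {α | IsEven α}) hα hc.le).mem_ageCone (Finset.mem_singleton_self _)
      have h2 : φ (monomial α c) = fun γ => if γ = α then c else 0 := by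
        funext γ
        simp [φ, coeff_monomial, eq_comm]
      change φ (monomial α c) ∈ ageCone (expEval (n := n)) {α | IsEven α}
      rwa [h2]
  exact h hf

lemma mem_Lam {f : MvPolynomial (Fin n) ℝ} {α : Fin n →₀ ℕ} :
    α ∈ Lam f ↔ IsEven α ∧ 0 < coeff α f := by
  classical
  rw [Lam, Finset.mem_filter, mem_support_iff]
  exact ⟨fun h => h.2, fun h => ⟨h.2.ne', h⟩⟩

lemma mem_Gam {f : MvPolynomial (Fin n) ℝ} {α : Fin n →₀ ℕ} :
    α ∈ Gam f ↔ coeff α f ≠ 0 ∧ α ∉ Lam f := by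
  rw [Gam, Finset.mem_sdiff, mem_support_iff]

/-- The coefficients `c β` distribute the even positive terms of `f` among its other terms so that
each of the latter is dominated on the positive orthant. -/
def IsDistribution (f : MvPolynomial (Fin n) ℝ) (c : (Fin n →₀ ℕ) → (Fin n →₀ ℕ) → ℝ) : Prop :=
  (∀ β ∈ Gam f, ∀ α ∈ Lam f, 0 ≤ c β α) ∧ (∀ α ∈ Lam f, ∑ β ∈ Gam f, c β α ≤ coeff α f) ∧
    ∀ β ∈ Gam f, ∀ y, |coeff β f| * expEval y β ≤ ∑ α ∈ Lam f, c β α * expEval y α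

lemma IsSONC.exists_isDistribution {f : MvPolynomial (Fin n) ℝ} (hf : IsSONC f) :
    ∃ c, IsDistribution f c := by
  classical
  exact exists_distribution_of_mem_ageCone hf.mem_ageCone (Lam f) (Gam f)
    (fun _ => mem_Lam) fun _ => mem_Gam

lemma coeff_toRatPoly (f : MvPolynomial (Fin n) ℝ) (α : Fin n →₀ ℕ) :
    (toRatPoly f).coeff (toRat α) = coeff α f := by
  classical
  rw [toRatPoly, AddMonoidAlgebra.coeff_sum, Finsupp.finsetSum_apply]
  simp only [ratMonomial, AddMonoidAlgebra.coeff_single]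
  rw [Finset.sum_eq_single α]
  · simp
  · intro γ _ hne
    exact Finsupp.single_eq_of_ne fun h => hne (toRat_injective h).symm
  · intro h
    rw [notMem_support_iff.1 h]
    simp

lemma exists_eq_toRat_of_coeff_ne_zero {f : MvPolynomial (Fin n) ℝ} {u : Fin n → ℚ}
    (hu : (toRatPoly f).coeff u ≠ 0) : ∃ α, toRat α = u := by
  by_contra! h
  refine hu ?_
  rw [toRatPoly, AddMonoidAlgebra.coeff_sum, Finsupp.finsetSum_apply]
  exact Finset.sum_eq_zero fun α _ => Finsupp.single_eq_of_ne fun h1 => h α h1.symm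

/-- The exponents of `toRatPoly f` are lattice points, and evenness means the same in both settings.
Hence fractional exponents in the summands leave no trace in the distribution. -/
lemma exists_isDistribution_of_mem_ageCone {f : MvPolynomial (Fin n) ℝ}
    (hf : (⇑(toRatPoly f).coeff : (Fin n → ℚ) → ℝ) ∈
      ageCone (ratExpEval (n := n)) (evenPoints n)) :
    ∃ c, IsDistribution f c := by
  classical
  have hmem : ∀ (T : Finset (Fin n →₀ ℕ)) α, toRat α ∈ T.image toRat ↔ α ∈ T :=
    fun T α => toRat_injective.mem_finset_image
  have hsum : ∀ (T : Finset (Fin n →₀ ℕ)) (g : (Fin n → ℚ) → ℝ),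
      ∑ u ∈ T.image toRat, g u = ∑ α ∈ T, g (toRat α) :=
    fun T g => Finset.sum_image toRat_injective.injOn
  obtain ⟨c, h1, h2, h3⟩ := exists_distribution_of_mem_ageCone hf ((Lam f).image toRat)
    ((Gam f).image toRat)
    (fun u => by
      by_cases hu : ∃ α, toRat α = u
      · obtain ⟨α, rfl⟩ := hu
        rw [hmem, mem_Lam, coeff_toRatPoly, toRat_mem_evenPoints]
      · refine iff_of_false (fun h => ?_)
          fun h => hu (exists_eq_toRat_of_coeff_ne_zero h.2.ne')
        obtain ⟨α, -, h⟩ := Finset.mem_image.1 h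
        exact hu ⟨α, h⟩)
    (fun u => by
      by_cases hu : ∃ α, toRat α = u
      · obtain ⟨α, rfl⟩ := hu
        rw [hmem, hmem, mem_Gam, coeff_toRatPoly]
      · refine iff_of_false (fun h => ?_)
          fun h => hu (exists_eq_toRat_of_coeff_ne_zero h.1)
        obtain ⟨α, -, h⟩ := Finset.mem_image.1 h
        exact hu ⟨α, h⟩)
  refine ⟨fun β α => c (toRat β) (toRat α), fun β hβ α hα => ?_, fun α hα => ?_,
    fun β hβ y => ?_⟩
  · exact h1 _ ((hmem _ _).2 hβ) _ ((hmem _ _).2 hα)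
  · have := h2 _ ((hmem _ _).2 hα)
    rwa [hsum, coeff_toRatPoly] at this
  · have := h3 _ ((hmem _ _).2 hβ) y
    rw [hsum, coeff_toRatPoly] at this
    simpa only [ratExpEval_toRat] using this

/-- Distributions refine to cancellation-free circuit decompositions with certificates. The
decomposition is stated for an arbitrary additive interpretation `φ` of the monomials. -/
theorem IsDistribution.exists_decomposition {f : MvPolynomial (Fin n) ℝ}
    {c : (Fin n →₀ ℕ) → (Fin n →₀ ℕ) → ℝ} (hc : IsDistribution f c) :
    ∃ (N D : (Fin n →₀ ℕ) → Finset (Fin n →₀ ℕ) → ℝ) (s : (Fin n →₀ ℕ) → (Fin n →₀ ℕ) → ℝ)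
      (r : (Fin n →₀ ℕ) → ℝ),
      (∀ β ∈ Gam f, ∀ Δ, 0 ≤ N β Δ ∧
        |D β Δ| ≤ N β Δ * Real.exp (∑ α ∈ Δ, bary Δ β α * s β α)) ∧
      (∀ α ∈ Lam f, 0 ≤ r α) ∧ (∀ α ∈ unused f, r α = coeff α f) ∧
      ∀ {X : Type} [AddCommGroup X] (φ : (Fin n →₀ ℕ) → ℝ →+ X),
        ∑ α ∈ f.support, φ α (coeff α f) =
          ∑ β ∈ Gam f, ∑ Δ ∈ simplices f β,
            (∑ α ∈ Δ, φ α (N β Δ * bary Δ β α * Real.exp (s β α)) - φ β (D β Δ)) +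
          ∑ α ∈ Lam f, φ α (r α) := by
  classical
  obtain ⟨h1, h2, h3⟩ := hc
  have hex := fun β (hβ : β ∈ Gam f) => exists_circuit_certificates (Lam f) β (c β) (h1 β hβ)
    (abs_nonneg (coeff β f)) (h3 β hβ)
  choose! N D s hN hD0 hDN hDs hNc using hex
  set C : (Fin n →₀ ℕ) → Finset (Fin n →₀ ℕ) → (Fin n →₀ ℕ) → ℝ := fun β Δ α =>
    N β Δ * bary Δ β α * Real.exp (s β α) with hC
  have hC0 : ∀ β Δ α, α ∉ Δ → C β Δ α = 0 := fun β Δ α h => by simp [hC, bary_eq_zero h]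
  -- The certificates concern `|f_β|`; here the sign is restored. Circuits subtract their inner
  -- term, so `D'` has the sign opposite to `f_β`.
  set D' : (Fin n →₀ ℕ) → Finset (Fin n →₀ ℕ) → ℝ := fun β Δ =>
    if 0 ≤ coeff β f then - D β Δ else D β Δ with hD'
  have hD's : ∀ β ∈ Gam f, ∑ Δ ∈ simplices f β, D' β Δ = - coeff β f := by
    intro β hβ
    have := hDs β hβ
    simp only [hD', simplices_eq]
    split_ifs with h
    · rw [Finset.sum_neg_distrib, this, abs_of_nonneg h]
    · rw [this, abs_of_neg (not_le.1 h)]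
  set r : (Fin n →₀ ℕ) → ℝ := fun α =>
    coeff α f - ∑ β ∈ Gam f, ∑ Δ ∈ simplices f β, C β Δ α with hr
  refine ⟨N, D', s, r, fun β hβ Δ => ⟨hN β hβ Δ, ?_⟩, fun α hα => ?_, fun α hα => ?_, ?_⟩
  · have h4 : |D' β Δ| = D β Δ := by
      simp only [hD']
      split_ifs
      · rw [abs_neg, abs_of_nonneg (hD0 β hβ Δ)]
      · rw [abs_of_nonneg (hD0 β hβ Δ)]
    rw [h4]
    exact hDN β hβ Δ
  · exact sub_nonneg.2 ((Finset.sum_le_sum fun β hβ => hNc β hβ α hα).trans (h2 α hα))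
  · have h4 := (Finset.mem_filter.1 hα).2
    simp only [hr]
    rw [Finset.sum_eq_zero fun β hβ => Finset.sum_eq_zero fun Δ hΔ =>
      hC0 β Δ α (h4 β hβ Δ hΔ), sub_zero]
  · intro X _ φ
    have h4 : ∀ β ∈ Gam f, ∀ Δ ∈ simplices f β,
        ∑ α ∈ Δ, φ α (C β Δ α) = ∑ α ∈ Lam f, φ α (C β Δ α) := by
      intro β _ Δ hΔ
      rw [simplices_eq, mem_simplicesIn] at hΔ
      exact Finset.sum_subset hΔ.1 fun α _ hα => by rw [hC0 β Δ α hα, map_zero]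
    have h5 : ∑ β ∈ Gam f, ∑ Δ ∈ simplices f β, (∑ α ∈ Δ, φ α (C β Δ α) - φ β (D' β Δ)) =
        ∑ α ∈ Lam f, φ α (∑ β ∈ Gam f, ∑ Δ ∈ simplices f β, C β Δ α) +
          ∑ β ∈ Gam f, φ β (coeff β f) := by
      simp only [map_sum]
      rw [Finset.sum_comm (s := Lam f), ← Finset.sum_add_distrib]
      refine Finset.sum_congr rfl fun β hβ => ?_
      rw [Finset.sum_sub_distrib, Finset.sum_congr rfl (h4 β hβ), Finset.sum_comm (s := Lam f),
        ← map_sum, hD's β hβ, map_neg, sub_neg_eq_add]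
    have hsub : Lam f ⊆ f.support := Finset.filter_subset _ _
    have h6 : ∑ α ∈ f.support, φ α (coeff α f) =
        ∑ α ∈ Gam f, φ α (coeff α f) + ∑ α ∈ Lam f, φ α (coeff α f) := by
      rw [Gam]
      convert (Finset.sum_sdiff hsub).symm
    rw [h5, h6]
    simp only [hr, map_sub, Finset.sum_sub_distrib]
    abel

lemma IsDistribution.isSONC {f : MvPolynomial (Fin n) ℝ}
    {c : (Fin n →₀ ℕ) → (Fin n →₀ ℕ) → ℝ} (hc : IsDistribution f c) : IsSONC f := by
  obtain ⟨N, D, s, r, h1, h2, -, h3⟩ := hc.exists_decomposition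
  have h4 := h3 fun α => (monomial (R := ℝ) α).toAddMonoidHom
  simp only [LinearMap.toAddMonoidHom_coe] at h4
  rw [support_sum_monomial_coeff] at h4
  rw [h4]
  refine (AddSubmonoid.closure _).add_mem ((AddSubmonoid.closure _).sum_mem fun β hβ =>
    (AddSubmonoid.closure _).sum_mem fun Δ hΔ => ?_)
    ((AddSubmonoid.closure _).sum_mem fun α hα => ?_)
  · rw [simplices_eq, mem_simplicesIn] at hΔ
    exact isSONC_circuit (fun α hα => (mem_Lam.1 (hΔ.1 hα)).1) hΔ.2.1 hΔ.2.2 (h1 β hβ Δ).1 _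
      (h1 β hβ Δ).2
  · exact isSONC_monomial (mem_Lam.1 hα).1 (h2 α hα)

end Sonc

/-! ### Binomial squares along mediated sets. -/

namespace Sonc

variable {n : ℕ}

open MvPolynomial

lemma mem_biSup_addSubmonoid {κ X : Type*} [AddCommMonoid X] (K : κ → AddSubmonoid X)
    (s : Finset κ) {x : X} (hx : x ∈ ⨆ i ∈ s, K i) :
    ∃ g : κ → X, (∀ i ∈ s, g i ∈ K i) ∧ x = ∑ i ∈ s, g i := by
  classical
  induction s using Finset.induction_on generalizing x with
  | empty => exact ⟨0, by simp, by simpa using hx⟩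
  | insert a s ha ih =>
    rw [Finset.iSup_insert, AddSubmonoid.mem_sup] at hx
    obtain ⟨y, hy, z, hz, rfl⟩ := hx
    obtain ⟨g, hg, rfl⟩ := ih hz
    refine ⟨Function.update g a y, fun i hi => ?_, ?_⟩
    · by_cases h : i = a
      · subst h
        simpa using hy
      · rw [Function.update_of_ne h]
        exact hg i ((Finset.mem_insert.1 hi).resolve_left h)
    · rw [Finset.sum_insert ha, Function.update_self]
      congr 1
      refine Finset.sum_congr rfl fun i hi => ?_
      rw [Function.update_of_ne]
      rintro rfl
      exact ha hi

lemma mem_biSup_of_mem {κ X : Type*} [AddCommMonoid X] {K : κ → AddSubmonoid X}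
    {s : Finset κ} {i : κ} (hi : i ∈ s) {x : X} (hx : x ∈ K i) : x ∈ ⨆ i ∈ s, K i :=
  (le_iSup₂_of_le (f := fun i (_ : i ∈ s) => K i) i hi le_rfl) hx

lemma ratMonomial_add (u : Fin n → ℚ) (a b : ℝ) :
    ratMonomial u (a + b) = ratMonomial u a + ratMonomial u b :=
  AddMonoidAlgebra.single_add u a b

lemma ratMonomial_sub (u : Fin n → ℚ) (a b : ℝ) :
    ratMonomial u (a - b) = ratMonomial u a - ratMonomial u b :=
  map_sub (AddMonoidAlgebra.singleAddHom u) a b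

lemma ratMonomial_zero (u : Fin n → ℚ) : ratMonomial u 0 = 0 :=
  AddMonoidAlgebra.single_zero u

lemma smul_ratMonomial (a : ℝ) (u : Fin n → ℚ) (b : ℝ) :
    a • ratMonomial u b = ratMonomial u (a * b) :=
  AddMonoidAlgebra.smul_single a u b

lemma binomialSquare_eq (v w : Fin n → ℚ) (a b : ℝ) :
    binomialSquare v w a b = ratMonomial v (a ^ 2) + ratMonomial w (b ^ 2) -
      ratMonomial ((1 / 2 : ℚ) • (v + w)) (2 * (a * b)) := by
  have h1 : ∀ v : Fin n → ℚ, (1 / 2 : ℚ) • v + (1 / 2 : ℚ) • v = v := fun v => by module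
  have h2 : (1 / 2 : ℚ) • w + (1 / 2 : ℚ) • v = (1 / 2 : ℚ) • v + (1 / 2 : ℚ) • w :=
    add_comm _ _
  rw [two_mul, ratMonomial_add, smul_add]
  simp only [binomialSquare, ratMonomial, sq, sub_mul, mul_sub,
    AddMonoidAlgebra.single_mul_single, h1, h2, mul_comm b a]
  abel

/-- The nonnegative signomials supported at `v`, `w` and their midpoint. -/
def binomialCone (v w : Fin n → ℚ) : AddSubmonoid (AddMonoidAlgebra ℝ (Fin n → ℚ)) where
  carrier := {g | ∃ p q r : ℝ, 0 ≤ p ∧ 0 ≤ q ∧ r ^ 2 ≤ p * q ∧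
    g = ratMonomial v p + ratMonomial w q - ratMonomial ((1 / 2 : ℚ) • (v + w)) (2 * r)}
  zero_mem' := ⟨0, 0, 0, le_rfl, le_rfl, by norm_num, by simp [ratMonomial_zero]⟩
  add_mem' := by
    rintro _ _ ⟨p, q, r, hp, hq, hr, rfl⟩ ⟨p', q', r', hp', hq', hr', rfl⟩
    refine ⟨p + p', q + q', r + r', by positivity, by positivity, ?_, ?_⟩
    · have h1 : (2 * (r * r')) ^ 2 ≤ (p * q' + p' * q) ^ 2 := by
        have h2 := mul_le_mul hr hr' (sq_nonneg _) (by positivity)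
        nlinarith [sq_nonneg (p * q' - p' * q)]
      have h3 := abs_le_of_sq_le_sq h1 (by positivity)
      have h4 := (abs_le.1 h3).2
      nlinarith
    · simp only [mul_add, ratMonomial_add]
      abel

/-- A positive semidefinite binary quadratic form is a sum of two squares by completing the square;
this is the origin of the index `j = 1, 2`. -/
lemma exists_binomialSquare {v w : Fin n → ℚ} {g : AddMonoidAlgebra ℝ (Fin n → ℚ)}
    (hg : g ∈ binomialCone v w) :
    ∃ a b : Fin 2 → ℝ, g = ∑ j, binomialSquare v w (a j) (b j) := by
  obtain ⟨p, q, r, hp, hq, hr, rfl⟩ := hg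
  rcases hp.eq_or_lt with h | h
  · have hr0 : r = 0 := by
      rw [← h, zero_mul] at hr
      exact pow_eq_zero_iff two_ne_zero |>.1 (le_antisymm hr (sq_nonneg r))
    refine ⟨![0, 0], ![Real.sqrt q, 0], ?_⟩
    simp [Fin.sum_univ_two, binomialSquare_eq, ← h, hr0, ratMonomial_zero, Real.sq_sqrt hq]
  · have hsp : 0 < Real.sqrt p := Real.sqrt_pos.2 h
    have hq' : 0 ≤ q - r ^ 2 / p := by
      rw [sub_nonneg, div_le_iff₀ h]
      linarith
    refine ⟨![Real.sqrt p, 0], ![r / Real.sqrt p, Real.sqrt (q - r ^ 2 / p)], ?_⟩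
    have e1 : Real.sqrt p * (r / Real.sqrt p) = r := mul_div_cancel₀ r hsp.ne'
    have e2 : (r / Real.sqrt p) ^ 2 = r ^ 2 / p := by rw [div_pow, Real.sq_sqrt hp]
    simp only [Fin.sum_univ_two, binomialSquare_eq, Matrix.cons_val_zero, Matrix.cons_val_one,
      e1, e2, Real.sq_sqrt hp, Real.sq_sqrt hq', ratMonomial_sub]
    simp [ratMonomial_zero]
    abel

section

variable {Δ : Finset (Fin n →₀ ℕ)} {β : Fin n →₀ ℕ} {M : Finset (Fin n → ℚ)}
  {v w : (Fin n → ℚ) → (Fin n → ℚ)} (hΔ : IsSimplexVertices Δ) (h : InSimplexInterior Δ β)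
  (hβ : β ∉ Δ) (hM : ratVertices Δ ⊆ M) (hβM : toRat β ∈ M)
  (hvw : ∀ u ∈ M \ ratVertices Δ, IsAverage M u (v u) (w u))
include hΔ h hβ hM hβM hvw

/-- Certified circuit signomials are sums of binomial squares along any mediated set. -/
lemma circuit_mem_iSup_binomialCone {N D : ℝ} (hN : 0 ≤ N) (s : (Fin n →₀ ℕ) → ℝ)
    (hD : |D| ≤ N * Real.exp (∑ α ∈ Δ, bary Δ β α * s α)) :
    ∑ α ∈ Δ, ratMonomial (toRat α) (N * bary Δ β α * Real.exp (s α)) -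
      ratMonomial (toRat β) D ∈ ⨆ u ∈ M \ ratVertices Δ, binomialCone (v u) (w u) := by
  classical
  obtain ⟨G, hG0, hGβ, hG⟩ := exists_bary_identity hΔ h hβ hM hβM hvw
  obtain ⟨l, hl1, hl2⟩ := exists_harmonic_extension hvw (Function.extend toRat s 0)
  have hlΔ : ∀ α ∈ Δ, l (toRat α) = s α := by
    intro α hα
    rw [hl1 _ (Finset.mem_image_of_mem _ hα), toRat_injective.extend_apply]
  have hlβ : l (toRat β) = ∑ α ∈ Δ, bary Δ β α * s α := by
    have h1 := hG l
    rw [Finset.sum_eq_zero fun u hu => by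
      rw [smul_eq_mul, smul_eq_mul, hl2 u hu, sub_self, mul_zero]] at h1
    rw [← sub_eq_zero.1 h1.symm]
    exact Finset.sum_congr rfl fun α hα => by rw [hlΔ α hα, smul_eq_mul]
  set K : (Fin n → ℚ) → ℝ := fun u => N * Real.exp (l u) with hK
  have hK0 : ∀ u, 0 ≤ K u := fun u => mul_nonneg hN (Real.exp_pos _).le
  rw [← hlβ] at hD
  have hβU : toRat β ∈ M \ ratVertices Δ := by
    refine Finset.mem_sdiff.2 ⟨hβM, fun h1 => hβ ?_⟩
    obtain ⟨α, hα, he⟩ := Finset.mem_image.1 h1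
    rwa [← toRat_injective he]
  -- The Green-weighted squares yield the circuit with inner coefficient `K(β)`; the slack `e` is
  -- credited to the middle term at `u = β`. As `0 ≤ e ≤ 2 K(β)` and `G(β) ≥ 1/2`, the half
  -- coefficient `G K - e/2` stays in `[-G K, G K]`.
  set e : ℝ := K (toRat β) - D with he
  have he1 : |D| ≤ K (toRat β) := hD
  have hrep : ∑ α ∈ Δ, ratMonomial (toRat α) (N * bary Δ β α * Real.exp (s α)) -
      ratMonomial (toRat β) D = ∑ u ∈ M \ ratVertices Δ,
        (ratMonomial (v u) (G u * K (v u)) + ratMonomial (w u) (G u * K (w u)) -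
          ratMonomial u (2 * (G u * K u - if u = toRat β then e / 2 else 0))) := by
    have h1 := hG fun u => ratMonomial u (K u)
    simp only [smul_sub, smul_add, smul_ratMonomial] at h1
    have h2 : ∑ u ∈ M \ ratVertices Δ, ratMonomial u (if u = toRat β then e else 0) =
        ratMonomial (toRat β) e := by
      rw [Finset.sum_eq_single (toRat β) (fun u _ hne => by rw [if_neg hne, ratMonomial_zero])
        (fun h => absurd hβU h), if_pos rfl]
    have h3 : ∀ u ∈ M \ ratVertices Δ,
        ratMonomial (v u) (G u * K (v u)) + ratMonomial (w u) (G u * K (w u)) -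
          ratMonomial u (2 * (G u * K u - if u = toRat β then e / 2 else 0)) =
        (ratMonomial (v u) (G u * K (v u)) + ratMonomial (w u) (G u * K (w u)) -
          ratMonomial u (G u * (2 * K u))) + ratMonomial u (if u = toRat β then e else 0) := by
      intro u _
      rw [show 2 * (G u * K u - if u = toRat β then e / 2 else 0) =
        G u * (2 * K u) - if u = toRat β then e else 0 by split_ifs <;> ring, ratMonomial_sub]
      abel
    rw [Finset.sum_congr rfl h3, Finset.sum_add_distrib, h1, h2, he, ratMonomial_sub]
    have h4 : ∑ α ∈ Δ, ratMonomial (toRat α) (bary Δ β α * K (toRat α)) =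
        ∑ α ∈ Δ, ratMonomial (toRat α) (N * bary Δ β α * Real.exp (s α)) :=
      Finset.sum_congr rfl fun α hα => by
        simp only [hK]
        rw [hlΔ α hα]
        congr 1
        ring
    rw [h4]
    abel
  rw [hrep]
  refine AddSubmonoid.sum_mem _ fun u hu => mem_biSup_of_mem hu ?_
  have hmid := (hvw u hu).2.2.2
  refine ⟨G u * K (v u), G u * K (w u), G u * K u - if u = toRat β then e / 2 else 0,
    mul_nonneg (hG0 u hu) (hK0 _), mul_nonneg (hG0 u hu) (hK0 _), ?_, by rw [← hmid]⟩
  have h1 : K (v u) * K (w u) = K u ^ 2 := by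
    simp only [hK]
    have h2 : Real.exp (l (v u)) * Real.exp (l (w u)) = Real.exp (l u) ^ 2 := by
      rw [← Real.exp_add, ← hl2 u hu, ← Real.exp_nat_mul]
      norm_cast
    linear_combination N ^ 2 * h2
  have h3 : G u * K (v u) * (G u * K (w u)) = (G u * K u) ^ 2 := by
    linear_combination G u ^ 2 * h1
  rw [h3]
  refine sq_le_sq' ?_ ?_
  · split_ifs with hu'
    · subst hu'
      have h4 := mul_le_mul_of_nonneg_right hGβ (hK0 (toRat β))
      have h5 := (abs_le.1 he1).1
      linarith
    · linarith [mul_nonneg (hG0 u hu) (hK0 u)]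
  · split_ifs with hu'
    · have h5 := (abs_le.1 he1).2
      linarith
    · linarith

/-- The vertices of a simplex occur in the midpoint relations of a mediated set. -/
lemma vertex_mem_iSup_binomialCone {α : Fin n →₀ ℕ} (hα : α ∈ Δ) {r : ℝ} (hr : 0 ≤ r) :
    ratMonomial (toRat α) r ∈ ⨆ u ∈ M \ ratVertices Δ, binomialCone (v u) (w u) := by
  classical
  obtain ⟨G, -, -, hG⟩ := exists_bary_identity hΔ h hβ hM hβM hvw
  -- Otherwise the mean value identity, applied to the indicator of the vertex, would make its
  -- barycentric coordinate zero.
  have hex : ∃ u ∈ M \ ratVertices Δ, v u = toRat α ∨ w u = toRat α := by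
    by_contra! hno
    have h1 := hG fun u => if u = toRat α then (1 : ℝ) else 0
    have hne : ∀ u ∈ M \ ratVertices Δ, u ≠ toRat α := by
      rintro u hu rfl
      exact (Finset.mem_sdiff.1 hu).2 (Finset.mem_image_of_mem _ hα)
    have hβα : toRat β ≠ toRat α := fun h => hβ (by rwa [toRat_injective h])
    rw [Finset.sum_eq_zero fun u hu => by
      rw [if_neg (hno u hu).1, if_neg (hno u hu).2, if_neg (hne u hu)]; simp,
      Finset.sum_eq_single α (fun γ _ hγ => by
        rw [if_neg fun h => hγ (toRat_injective h), smul_zero]) (fun h => absurd hα h),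
      if_pos rfl, if_neg hβα] at h1
    have h2 := bary_pos h hα
    simp only [smul_eq_mul, mul_one, sub_zero] at h1
    exact h2.ne h1
  obtain ⟨u, hu, hvα | hwα⟩ := hex
  · refine mem_biSup_of_mem hu ⟨r, 0, 0, hr, le_rfl, by simp, ?_⟩
    simp [hvα, ratMonomial_zero]
  · refine mem_biSup_of_mem hu ⟨0, r, 0, le_rfl, hr, by simp, ?_⟩
    simp [hwα, ratMonomial_zero]

end

/-- The points of a midpoint relation in an odd mediated set are even. -/
lemma IsOddMediated.left_mem_evenPoints {Δ : Finset (Fin n →₀ ℕ)} {β : Fin n →₀ ℕ}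
    {M : Finset (Fin n → ℚ)} (hM : IsOddMediated Δ β M) {u v w : Fin n → ℚ} (hu : u ∈ M)
    (h : IsAverage M u v w) : v ∈ evenPoints n := by
  obtain ⟨-, -, h1, h2⟩ := hM
  obtain ⟨hv, hw, hne, hmid⟩ := h
  have heven : ∀ x ∈ M, x ≠ toRat β → x ∈ evenPoints n :=
    fun x hx hxβ => mem_evenPoints.2 ⟨h1 x hx, h2 x hx hxβ⟩
  -- Only `β` may be non-even in `M`. If `v = β`, then `w` is even and `v / 2 = u - w / 2` has odd
  -- denominators, so `β` is even after all.
  by_cases hvβ : v = toRat β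
  · have hwβ : w ≠ toRat β := fun h => hne (hvβ.trans h.symm)
    intro i
    have h3 := heven w hw hwβ i
    have h4 := h1 u hu i
    have h5 : v i / 2 = u i - w i / 2 := by
      rw [hmid]
      simp
      ring
    rw [h5]
    exact oddDen.sub_mem h4 h3
  · exact heven v hv hvβ

lemma IsAverage.symm {M : Finset (Fin n → ℚ)} {u v w : Fin n → ℚ} (h : IsAverage M u v w) :
    IsAverage M u w v :=
  ⟨h.2.1, h.1, h.2.2.1.symm, by rw [add_comm w v]; exact h.2.2.2⟩

/-- The combinations of rational monomials whose coefficient functions are sums of AGE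
signomials. -/
noncomputable def ratAgeCone (n : ℕ) : AddSubmonoid (AddMonoidAlgebra ℝ (Fin n → ℚ)) :=
  (ageCone (ratExpEval (n := n)) (evenPoints n)).comap
    (Finsupp.coeFnAddHom.comp AddMonoidAlgebra.coeffAddEquiv.toAddMonoidHom)

lemma mem_ratAgeCone {g : AddMonoidAlgebra ℝ (Fin n → ℚ)} :
    g ∈ ratAgeCone n ↔
      (⇑g.coeff : (Fin n → ℚ) → ℝ) ∈ ageCone (ratExpEval (n := n)) (evenPoints n) := Iff.rfl

lemma coeff_ratMonomial (u x : Fin n → ℚ) [Decidable (x = u)] (c : ℝ) :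
    (ratMonomial u c).coeff x = if x = u then c else 0 := by
  rw [ratMonomial, AddMonoidAlgebra.coeff_single]
  split_ifs with h
  · rw [h, Finsupp.single_eq_same]
  · rw [Finsupp.single_eq_of_ne h]

lemma ratMonomial_mem_ratAgeCone {u : Fin n → ℚ} (hu : u ∈ evenPoints n) {c : ℝ} (hc : 0 ≤ c) :
    ratMonomial u c ∈ ratAgeCone n := by
  classical
  rw [mem_ratAgeCone]
  have h1 := (isAGE_single (ev := ratExpEval (n := n)) (fun y α => Real.exp_pos _) hu
    hc).mem_ageCone (Finset.mem_singleton_self _)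
  convert h1 using 1
  funext x
  exact coeff_ratMonomial u x c

/-- The square is AGE at the midpoint: both `(a p - b q)²` and its sign-flipped version `(a p + b
q)²` are nonnegative. Since `v ≠ w`, the midpoint differs from both endpoints. -/
lemma binomialSquare_mem_ratAgeCone {v w : Fin n → ℚ} (hv : v ∈ evenPoints n)
    (hw : w ∈ evenPoints n) (hne : v ≠ w) (a b : ℝ) :
    binomialSquare v w a b ∈ ratAgeCone n := by
  classical
  rw [mem_ratAgeCone, binomialSquare_eq]
  set u : Fin n → ℚ := (1 / 2 : ℚ) • (v + w) with hu
  have huv : u ≠ v := by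
    intro h
    refine hne ?_
    have : (2 : ℚ) • u = (2 : ℚ) • v := by rw [h]
    rw [hu, smul_smul] at this
    norm_num [two_smul] at this
    exact this.symm
  have huw : u ≠ w := by
    intro h
    refine hne ?_
    have : (2 : ℚ) • u = (2 : ℚ) • w := by rw [h]
    rw [hu, smul_smul] at this
    norm_num [two_smul] at this
    exact this
  have hcoeff : ∀ x, (ratMonomial v (a ^ 2) + ratMonomial w (b ^ 2) -
      ratMonomial u (2 * (a * b))).coeff x = (if x = v then a ^ 2 else 0) +
      (if x = w then b ^ 2 else 0) - if x = u then 2 * (a * b) else 0 := by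
    intro x
    rw [AddMonoidAlgebra.coeff_sub, AddMonoidAlgebra.coeff_add, Finsupp.sub_apply,
      Finsupp.add_apply, coeff_ratMonomial, coeff_ratMonomial, coeff_ratMonomial]
  refine IsAGE.mem_ageCone (S := {u, v, w}) (β := u) ⟨fun x hx => ?_, fun x hx he => ?_,
    fun x hx => ?_, fun y => ?_⟩ (by simp)
  · rw [hcoeff, if_neg hx, sub_zero]
    positivity
  · rw [hcoeff, if_neg hx, if_neg fun h : x = v => he (h ▸ hv),
      if_neg fun h : x = w => he (h ▸ hw)]
    simp
  · simp only [Finset.mem_insert, Finset.mem_singleton, not_or] at hx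
    rw [hcoeff, if_neg hx.1, if_neg hx.2.1, if_neg hx.2.2]
    simp
  · set p := Real.exp ((1 / 2 : ℝ) * ((fun i => (v i : ℝ)) ⬝ᵥ y)) with hp
    set q := Real.exp ((1 / 2 : ℝ) * ((fun i => (w i : ℝ)) ⬝ᵥ y)) with hq
    have e1 : ratExpEval y v = p ^ 2 := by
      rw [ratExpEval, hp, ← Real.exp_nat_mul]
      congr 1
      push_cast
      ring
    have e2 : ratExpEval y w = q ^ 2 := by
      rw [ratExpEval, hq, ← Real.exp_nat_mul]
      congr 1
      push_cast
      ring
    have e3 : ratExpEval y u = p * q := by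
      rw [ratExpEval, hp, hq, ← Real.exp_add]
      congr 1
      simp only [dotProduct, Finset.mul_sum]
      rw [← Finset.sum_add_distrib]
      refine Finset.sum_congr rfl fun i _ => ?_
      simp [hu]
      ring
    have hsum : ∑ x ∈ {u, v, w}, (ratMonomial v (a ^ 2) + ratMonomial w (b ^ 2) -
        ratMonomial u (2 * (a * b))).coeff x * ratExpEval y x =
        a ^ 2 * p ^ 2 + b ^ 2 * q ^ 2 - 2 * (a * b) * (p * q) := by
      rw [Finset.sum_insert (by simp [huv, huw]), Finset.sum_insert (by simp [hne]),
        Finset.sum_singleton, hcoeff, hcoeff, hcoeff, e1, e2, e3]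
      simp only [huv, huw, hne, huv.symm, huw.symm, hne.symm, if_true, if_false]
      ring
    rw [hsum, hcoeff, e3, if_neg huv, if_neg huw, if_pos rfl]
    refine ⟨?_, fun _ => ?_⟩
    · nlinarith [sq_nonneg (a * p - b * q)]
    · nlinarith [sq_nonneg (a * p + b * q)]

end Sonc

/-! ### Assembly of the equivalence. -/

theorem theorem3p5 {n : ℕ} (f : MvPolynomial (Fin n) ℝ) :
    (∀ β ∈ Gam f, ∀ Δ ∈ simplices f β, ∃ M : Finset (Fin n → ℚ), IsOddMediated Δ β M) ∧
    ∀ (M : (Fin n →₀ ℕ) → Finset (Fin n →₀ ℕ) → Finset (Fin n → ℚ))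
      (v w : (Fin n →₀ ℕ) → Finset (Fin n →₀ ℕ) → (Fin n → ℚ) → (Fin n → ℚ)),
      (∀ β ∈ Gam f, ∀ Δ ∈ simplices f β, IsOddMediated Δ β (M β Δ)) →
      (∀ β ∈ Gam f, ∀ Δ ∈ simplices f β, ∀ u ∈ M β Δ \ ratVertices Δ,
        IsAverage (M β Δ) u (v β Δ u) (w β Δ u)) →
      (IsSONC f ↔
        ∃ a b : (Fin n →₀ ℕ) → Finset (Fin n →₀ ℕ) → (Fin n → ℚ) → Fin 2 → ℝ,
          toRatPoly f =
            (∑ β ∈ Gam f, ∑ Δ ∈ simplices f β, ∑ u ∈ M β Δ \ ratVertices Δ, ∑ j : Fin 2,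
              binomialSquare (v β Δ u) (w β Δ u) (a β Δ u j) (b β Δ u j)) +
            ∑ α ∈ unused f, ratMonomial (toRat α) (f.coeff α)) := by
  classical
  have hsimp : ∀ β, ∀ Δ ∈ simplices f β,
      Δ ⊆ Lam f ∧ IsSimplexVertices Δ ∧ InSimplexInterior Δ β := by
    intro β Δ hΔ
    rwa [simplices_eq, mem_simplicesIn] at hΔ
  refine ⟨fun β _ Δ hΔ => exists_isOddMediated
    (fun α hα => (mem_Lam.1 ((hsimp β Δ hΔ).1 hα)).1) (hsimp β Δ hΔ).2.1 (hsimp β Δ hΔ).2.2,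
    fun M v w hM hvw => ⟨fun hf => ?_, ?_⟩⟩
  · obtain ⟨c, hc⟩ := hf.exists_isDistribution
    obtain ⟨N, D, s, r, h1, h2, h3, h4⟩ := hc.exists_decomposition
    have h5 := h4 fun α => AddMonoidAlgebra.singleAddHom (R := ℝ) (toRat α)
    change toRatPoly f = ∑ β ∈ Gam f, ∑ Δ ∈ simplices f β,
      (∑ α ∈ Δ, ratMonomial (toRat α) (N β Δ * bary Δ β α * Real.exp (s β α)) -
        ratMonomial (toRat β) (D β Δ)) + ∑ α ∈ Lam f, ratMonomial (toRat α) (r α) at h5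
    have hsub : unused f ⊆ Lam f := Finset.filter_subset _ _
    have hunused : ∑ α ∈ unused f, ratMonomial (toRat α) (r α) =
        ∑ α ∈ unused f, ratMonomial (toRat α) (f.coeff α) :=
      Finset.sum_congr rfl fun α hα => by rw [h3 α hα]
    rw [← Finset.sum_sdiff hsub, ← add_assoc, hunused] at h5
    rw [h5]
    -- Leftovers at vertices of simplices are grouped with the circuits: the formula has monomials
    -- only for unused points, so these leftovers must be absorbed by the squares.
    set X := ∑ β ∈ Gam f, ∑ Δ ∈ simplices f β,
      (∑ α ∈ Δ, ratMonomial (toRat α) (N β Δ * bary Δ β α * Real.exp (s β α)) -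
        ratMonomial (toRat β) (D β Δ)) + ∑ α ∈ Lam f \ unused f, ratMonomial (toRat α) (r α)
      with hX
    have hXmem : X ∈ ⨆ β ∈ Gam f, ⨆ Δ ∈ simplices f β, ⨆ u ∈ M β Δ \ ratVertices Δ,
        binomialCone (v β Δ u) (w β Δ u) := by
      have hβΔ : ∀ β ∈ Gam f, ∀ Δ ∈ simplices f β, β ∉ Δ := fun β hβ Δ hΔ h =>
        (mem_Gam.1 hβ).2 ((hsimp β Δ hΔ).1 h)
      refine AddSubmonoid.add_mem _ (AddSubmonoid.sum_mem _ fun β hβ =>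
        mem_biSup_of_mem hβ (AddSubmonoid.sum_mem _ fun Δ hΔ => mem_biSup_of_mem hΔ ?_))
        (AddSubmonoid.sum_mem _ fun α hα => ?_)
      · exact circuit_mem_iSup_binomialCone (hsimp β Δ hΔ).2.1 (hsimp β Δ hΔ).2.2
          (hβΔ β hβ Δ hΔ) (hM β hβ Δ hΔ).1.1 (hM β hβ Δ hΔ).2.1 (hvw β hβ Δ hΔ)
          (h1 β hβ Δ).1 _ (h1 β hβ Δ).2
      · obtain ⟨hα1, hα2⟩ := Finset.mem_sdiff.1 hα
        have hex : ∃ β ∈ Gam f, ∃ Δ ∈ simplices f β, α ∈ Δ := by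
          by_contra! h
          exact hα2 (Finset.mem_filter.2 ⟨hα1, h⟩)
        obtain ⟨β, hβ, Δ, hΔ, hαΔ⟩ := hex
        exact mem_biSup_of_mem hβ (mem_biSup_of_mem hΔ (vertex_mem_iSup_binomialCone
          (hsimp β Δ hΔ).2.1 (hsimp β Δ hΔ).2.2 (hβΔ β hβ Δ hΔ) (hM β hβ Δ hΔ).1.1
          (hM β hβ Δ hΔ).2.1 (hvw β hβ Δ hΔ) hαΔ (h2 α hα1)))
    obtain ⟨g, hg, hXg⟩ := mem_biSup_addSubmonoid _ _ hXmem
    have hg' := fun β hβ => mem_biSup_addSubmonoid _ _ (hg β hβ)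
    choose! g₂ hg₂ hgg₂ using hg'
    have hg₂' := fun β hβ Δ hΔ => mem_biSup_addSubmonoid _ _ (hg₂ β hβ Δ hΔ)
    choose! g₃ hg₃ hgg₃ using hg₂'
    have hab := fun β hβ Δ hΔ u hu => exists_binomialSquare (hg₃ β hβ Δ hΔ u hu)
    choose! a b hab using hab
    refine ⟨a, b, ?_⟩
    rw [hXg]
    congr 1
    refine Finset.sum_congr rfl fun β hβ => ?_
    rw [hgg₂ β hβ]
    refine Finset.sum_congr rfl fun Δ hΔ => ?_
    rw [hgg₃ β hβ Δ hΔ]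
    exact Finset.sum_congr rfl fun u hu => hab β hβ Δ hΔ u hu
  · rintro ⟨a, b, hab⟩
    have hmem : toRatPoly f ∈ ratAgeCone n := by
      rw [hab]
      refine AddSubmonoid.add_mem _ (AddSubmonoid.sum_mem _ fun β hβ =>
        AddSubmonoid.sum_mem _ fun Δ hΔ => AddSubmonoid.sum_mem _ fun u hu =>
        AddSubmonoid.sum_mem _ fun j _ => ?_) (AddSubmonoid.sum_mem _ fun α hα => ?_)
      · have h1 := hvw β hβ Δ hΔ u hu
        have huM := (Finset.mem_sdiff.1 hu).1
        exact binomialSquare_mem_ratAgeCone ((hM β hβ Δ hΔ).left_mem_evenPoints huM h1)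
          ((hM β hβ Δ hΔ).left_mem_evenPoints huM h1.symm) h1.2.2.1 _ _
      · have h1 := mem_Lam.1 (Finset.mem_filter.1 hα).1
        exact ratMonomial_mem_ratAgeCone (toRat_mem_evenPoints.2 h1.1) h1.2.le
    obtain ⟨c, hc⟩ := exists_isDistribution_of_mem_ageCone (mem_ratAgeCone.1 hmem)
    exact hc.isSONC
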